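/- Let $K$ be a field, $S=K[x_1,\dots,x_n]$ with $n\ge1$, and let ${\bf t}=(t_1,\dots,t_{d-1})\in\mathbb{Z}_{\ge0}^{d-1}$ with $d\ge2$. A monomial $u=x_{j_1}x_{j_2}\cdots x_{j_\ell}$ with $j_1\le j_2\le\dots\le j_\ell$ is called ${\bf t}$-spread if $\ell\le d$ and $j_{p+1}-j_p\ge t_p$ for $p=1,\dots,\ell-1$. For a ${\bf t}$-spread monomial $u\neq 1$ put $\operatorname{supp}(u)=\{j: x_j\mid u\}$, $\max(u)=\max\operatorname{supp}(u)$, $u'=u/x_{\max(u)}$, and $$\operatorname{supp}_{\bf t}(u)=\bigcup_{p=1}^{\ell-1}\{c\in\mathbb{Z}: j_p\le c\le j_p+t_p-1\}.$$ For a monomial ideal $I$, let $G(I)$ be its minimal set of monomial generators. A monomial ideal $I\subset S$ is a ${\bf t}$-spread strongly stable ideal if every $u\in G(I)$ is ${\bf t}$-spread and, for every ${\bf t}$-spread monomial $u\in I$ and all $j<i$ such that $x_i$ divides $u$ and $x_j(u/x_i)$ is ${\bf t}$-spread, one has $x_j(u/x_i)\in I$. Let $\varepsilon:S\to S/I$ be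 the canonical map and let $K_\bullet({\bf x};S/I)$ be the Koszul complex of ${\bf x}=x_1,\dots,x_n$ with respect to $S/I$: $K_i({\bf x};S/I)$ is the $i$-th exterior power of the free $S/I$-module with basis $e_1,\dots,e_n$, with differential $$\partial(e_{k_1}\wedge\dots\wedge e_{k_i})=\sum_{\ell=1}^i(-1)^{\ell+1}\varepsilon(x_{k_\ell})\,e_{k_1}\wedge\dots\wedge\widehat{e_{k_\ell}}\wedge\dots\wedge e_{k_i}.$$ Its homology is denoted $H_i({\bf x};S/I)$. Let $[m]=\{1,\dots,m\}$. For a set $A=\{a_1<\dots<a_m\}\subseteq[n]$ write ${\bf x}_A=x_{a_1}\cdots x_{a_m}$ and $e_A=e_{a_1}\wedge\dots\wedge e_{a_m}$, with ${\bf x}_\emptyset=1$ and $e_\emptyset=1$. For a ${\bf t}$-spread monomial $u\in I$, $u\ne1$, and $k<\max(u)$, let $k^{(u)}=\min\{j\in\operatorname{supp}(u): j>k\}$. For a set $F=\{f_1<\dots<f_m\}\subseteq[\max(u)-1]$, let $F^{(u)}$ be the sequence $f_1^{(u)}\le\dots\le f_m^{(u)}$ with repetitions kept, ${\bf x}_{F^{(u)}}=\prod_s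 x_{f_s^{(u)}}$, and $e_{F^{(u)}}=e_{f_1^{(u)}}\wedge\dots\wedge e_{f_m^{(u)}}$. For $\sigma\subseteq[\max(u)-1]\setminus\operatorname{supp}_{\bf t}(u)$ define $$e(u;\sigma)=\sum_{F\subseteq\sigma}(-1)^{u(\sigma;F)}\,\varepsilon\big({\bf x}_F\,(u'/{\bf x}_{F^{(u)}})\big)\;e_{\sigma\setminus F}\wedge e_{F^{(u)}}\wedge e_{\max(u)},$$ where a summand whose wedge product is zero is read as $0$ (in every other summand ${\bf x}_{F^{(u)}}$ divides $u'$). The integers $u(\sigma;F)$ are defined recursively: $u(\sigma;\emptyset)=0$; for $F\ne\emptyset$ and $k=\max(\sigma)$, put $D=\{r\in\sigma: r^{(u)}=k^{(u)}\}$ and $$u(\sigma;F)=\begin{cases}u(\sigma\setminus\{k\};F)+|F| & \text{if } k\notin F,\\ u(\sigma\setminus D;F\setminus D)+(|D|-1)(|F|+1)+1 & \text{if } k\in F.\end{cases}$$ **Theorem.** Let $I\subsetneq S$ be a proper ${\bf t}$-spread strongly stable ideal. Then, for every $i\ge1$, the elements $e(u;\sigma)$ with $u\in G(I)$, $\sigma\subseteq[\max(u)-1]\setminus\operatorname{supp}_{\bf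 t}(u)$ and $|\sigma|=i-1$ are cycles of $K_i({\bf x};S/I)$, and the family of their homology classes $[e(u;\sigma)]$, indexed by these pairs $(u,\sigma)$, is a $K$-basis of $H_i({\bf x};S/I)$. -/

import Mathlib

open MvPolynomial

namespace VectorSpread

noncomputable section

/-! ### The Koszul complex

The Koszul complex of a sequence `f` of `m` elements of a commutative ring `R` is the exterior
algebra of the free module `R ^ m` (with standard basis `e j`), graded by the exterior powers
`⋀[R]^i (Fin m → R)`, with the antiderivation `∂` determined by `∂ (e j) = f j`.
For `R = S ⧸ I` and `f j` the class of the variable `X j`, this is `K(x; S) ⊗ S ⧸ I`. -/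

section Koszul

variable {R : Type*} [CommRing R] {m : ℕ}

/-- The basis element `e_j` in degree one of the Koszul complex. -/
def koszulE (R : Type*) [CommRing R] {m : ℕ} (j : Fin m) : ExteriorAlgebra R (Fin m → R) :=
  ExteriorAlgebra.ι R (Pi.single j 1)

/-- The wedge product `e_{j₁} ∧ e_{j₂} ∧ ⋯` along a list of indices (in the order of the list,
repetitions allowed). -/
def koszulWedge (R : Type*) [CommRing R] {m : ℕ} (L : List (Fin m)) :
    ExteriorAlgebra R (Fin m → R) :=
  (L.map (koszulE R)).prod

/-- The Koszul differential: left contraction with the linear form `e_j ↦ f j`. -/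
def koszulD (f : Fin m → R) :
    ExteriorAlgebra R (Fin m → R) →ₗ[R] ExteriorAlgebra R (Fin m → R) :=
  CliffordAlgebra.contractLeft (Q := (0 : QuadraticForm R (Fin m → R)))
    (Fintype.linearCombination R f)

/-- `∂ 1 = 0`. -/
theorem koszulD_one (f : Fin m → R) : koszulD f 1 = 0 :=
  CliffordAlgebra.contractLeft_one _ _

/-- `∂ (v ∧ b) = ∂ v • b - v ∧ ∂ b` for `v` of degree one. -/
theorem koszulD_ι_mul (f : Fin m → R) (v : Fin m → R) (b : ExteriorAlgebra R (Fin m → R)) :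
    koszulD f (ExteriorAlgebra.ι R v * b)
      = Fintype.linearCombination R f v • b - ExteriorAlgebra.ι R v * koszulD f b :=
  CliffordAlgebra.contractLeft_ι_mul _ _ _

/-- `∂ (e_j ∧ b) = f_j • b - e_j ∧ ∂ b`. -/
theorem koszulD_koszulE_mul (f : Fin m → R) (j : Fin m) (b : ExteriorAlgebra R (Fin m → R)) :
    koszulD f (koszulE R j * b) = f j • b - koszulE R j * koszulD f b := by
  simp [koszulE, koszulD_ι_mul, Fintype.linearCombination_apply_single]

/-- `∂ ∘ ∂ = 0`. -/
theorem koszulD_koszulD (f : Fin m → R) (a : ExteriorAlgebra R (Fin m → R)) :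
    koszulD f (koszulD f a) = 0 :=
  CliffordAlgebra.contractLeft_contractLeft _ _

/-- `∂` maps the `(i+1)`-st exterior power to the `i`-th one. -/
theorem koszulD_mem (f : Fin m → R) (i : ℕ) (a : ExteriorAlgebra R (Fin m → R))
    (ha : a ∈ ⋀[R]^(i + 1) (Fin m → R)) : koszulD f a ∈ ⋀[R]^i (Fin m → R) := by
  induction i generalizing a with
  | zero =>
    change a ∈ LinearMap.range (ExteriorAlgebra.ι R) ^ (0 + 1) at ha
    change _ ∈ LinearMap.range (ExteriorAlgebra.ι R) ^ 0
    rw [zero_add, pow_one] at ha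
    obtain ⟨v, rfl⟩ := ha
    have h := koszulD_ι_mul f v 1
    rw [mul_one, koszulD_one, mul_zero, sub_zero] at h
    rw [h, pow_zero]
    exact Submodule.smul_mem _ _ (Submodule.mem_one.mpr ⟨1, map_one _⟩)
  | succ i ih =>
    change a ∈ LinearMap.range (ExteriorAlgebra.ι R) ^ (i + 1 + 1) at ha
    change _ ∈ LinearMap.range (ExteriorAlgebra.ι R) ^ (i + 1)
    rw [pow_succ'] at ha
    induction ha using Submodule.mul_induction_on' with
    | mem_mul_mem v hv b hb =>
      obtain ⟨v, rfl⟩ := hv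
      rw [koszulD_ι_mul]
      refine Submodule.sub_mem _ (Submodule.smul_mem _ _ hb) ?_
      rw [pow_succ']
      exact Submodule.mul_mem_mul (LinearMap.mem_range_self _ v) (ih b hb)
    | add a _ b _ h1 h2 =>
      rw [map_add]
      exact Submodule.add_mem _ h1 h2

/-- The Koszul cycles in homological degree `i`. -/
def koszulCycles (f : Fin m → R) (i : ℕ) : Submodule R (ExteriorAlgebra R (Fin m → R)) :=
  ⋀[R]^i (Fin m → R) ⊓ LinearMap.ker (koszulD f)

/-- The Koszul boundaries in homological degree `i`. -/
def koszulBoundaries (f : Fin m → R) (i : ℕ) : Submodule R (ExteriorAlgebra R (Fin m → R)) :=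
  (⋀[R]^(i + 1) (Fin m → R)).map (koszulD f)

theorem koszulBoundaries_le_koszulCycles (f : Fin m → R) (i : ℕ) :
    koszulBoundaries f i ≤ koszulCycles f i := by
  rintro _ ⟨a, ha, rfl⟩
  exact ⟨koszulD_mem f i a ha, koszulD_koszulD f a⟩

/-- The `i`-th Koszul homology module of the sequence `f`. -/
abbrev KoszulHomology (f : Fin m → R) (i : ℕ) : Type _ :=
  koszulCycles f i ⧸ (koszulBoundaries f i).submoduleOf (koszulCycles f i)

/-- The homology class of a Koszul cycle. -/
def koszulClass (f : Fin m → R) (i : ℕ) (a : koszulCycles f i) : KoszulHomology f i :=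
  Submodule.Quotient.mk a

end Koszul

/-! ### Vector-spread monomials and ideals

A monomial `x^u` of `S = K[x_1, …, x_n]` is given by its exponent vector `u : Fin n →₀ ℕ`;
the variables are indexed by `Fin n`, and the vector `t = (t_1, …, t_{d-1})` by `Fin (d - 1)`. -/

section Spread

variable {n d : ℕ}

/-- The nondecreasing list `j_1 ≤ j_2 ≤ ⋯ ≤ j_ℓ` with `x^u = x_{j_1} x_{j_2} ⋯ x_{j_ℓ}`. -/
def factorList (u : Fin n →₀ ℕ) : List (Fin n) :=
  (Finsupp.toMultiset u).sort (· ≤ ·)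

/-- `t`-spread monomials: `ℓ ≤ d` and `j_{i+1} - j_i ≥ t_i` for `i = 1, …, ℓ - 1`. -/
def IsSpread (t : Fin (d - 1) → ℕ) (u : Fin n →₀ ℕ) : Prop :=
  (factorList u).length ≤ d ∧
    ∀ (i : Fin (d - 1)) (h : (i : ℕ) + 1 < (factorList u).length),
      ((factorList u)[(i : ℕ)] : ℕ) + t i ≤ ((factorList u)[(i : ℕ) + 1] : ℕ)

open Classical in
/-- The `t`-spread support of a (`t`-spread) monomial, the union of the integer intervals
`[j_i, j_i + (t_i - 1)]` for `i = 1, …, ℓ - 1`. -/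
def spreadSupport (t : Fin (d - 1) → ℕ) (u : Fin n →₀ ℕ) : Finset (Fin n) :=
  Finset.univ.filter fun k =>
    ∃ (i : Fin (d - 1)) (h : (i : ℕ) + 1 < (factorList u).length),
      ((factorList u)[(i : ℕ)] : ℕ) ≤ (k : ℕ) ∧ (k : ℕ) < ((factorList u)[(i : ℕ)] : ℕ) + t i

/-- `max(u)`, the largest index of a variable dividing `x^u`; for `u = 1` it is the last index. -/
def maxVar [NeZero n] (u : Fin n →₀ ℕ) : Fin n :=
  if h : u.support.Nonempty then u.support.max' h else ⊤

/-- The set `[max(u) - 1] ∖ supp_t(u)`. -/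
def freeVars [NeZero n] (t : Fin (d - 1) → ℕ) (u : Fin n →₀ ℕ) : Finset (Fin n) :=
  Finset.Iio (maxVar u) \ spreadSupport t u

variable {K : Type*} [Field K]

/-- `I` is a monomial ideal. -/
def IsMonomialIdeal (I : Ideal (MvPolynomial (Fin n) K)) : Prop :=
  ∃ A : Set (Fin n →₀ ℕ), I = Ideal.span ((fun u => monomial u (1 : K)) '' A)

/-- The (exponents of the) minimal monomial generators `G(I)` of a monomial ideal `I`: the
monomials in `I` that are minimal with respect to divisibility. -/
def minGens (I : Ideal (MvPolynomial (Fin n) K)) : Set (Fin n →₀ ℕ) :=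
  {u | Minimal (fun v => monomial v (1 : K) ∈ I) u}

/-- `I` is a `t`-spread monomial ideal. -/
def IsSpreadIdeal (t : Fin (d - 1) → ℕ) (I : Ideal (MvPolynomial (Fin n) K)) : Prop :=
  IsMonomialIdeal I ∧ ∀ u ∈ minGens I, IsSpread t u

/-- `I` is a `t`-spread strongly stable ideal: it is a `t`-spread monomial ideal and, for every
`t`-spread monomial `u ∈ I`, every `x_i` dividing `u` and every `j < i` such that `x_j (u / x_i)`
is `t`-spread, `x_j (u / x_i)` belongs to `I`. -/
def IsSpreadStronglyStable (t : Fin (d - 1) → ℕ) (I : Ideal (MvPolynomial (Fin n) K)) : Prop :=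
  IsSpreadIdeal t I ∧
    ∀ u : Fin n →₀ ℕ, IsSpread t u → monomial u (1 : K) ∈ I →
      ∀ i ∈ u.support, ∀ j < i,
        IsSpread t (Finsupp.single j 1 + (u - Finsupp.single i 1)) →
          monomial (Finsupp.single j 1 + (u - Finsupp.single i 1)) (1 : K) ∈ I

end Spread

/-! ### The cycles `e(u; σ)` -/

section Cycles

variable {n : ℕ}

/-- `k^{(u)} = min {j ∈ supp(u) : j > k}` (this set is nonempty for `k < max(u)`). -/
def nextVar (u : Fin n →₀ ℕ) (k : Fin n) : Fin n :=
  if h : (u.support.filter fun j => k < j).Nonempty then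
    (u.support.filter fun j => k < j).min' h
  else k

/-- The exponent `u(σ; F)` of the sign of the summand of `e(u; σ)` belonging to `F ⊆ σ`.
It is `0` for `F = ∅`, and for `F ≠ ∅` it is defined recursively. -/
def signExp (u : Fin n →₀ ℕ) (σ F : Finset (Fin n)) : ℕ :=
  if h : F.Nonempty ∧ σ.Nonempty then
    if σ.max' h.2 ∉ F then
      signExp u (σ.erase (σ.max' h.2)) F + F.card
    else
      signExp u (σ.filter fun k => nextVar u k ≠ nextVar u (σ.max' h.2))
          (F.filter fun k => nextVar u k ≠ nextVar u (σ.max' h.2))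
        + ((σ.filter fun k => nextVar u k = nextVar u (σ.max' h.2)).card - 1) * (F.card + 1) + 1
  else 0
termination_by σ.card
decreasing_by
  · exact Finset.card_erase_lt_of_mem (Finset.max'_mem _ _)
  · exact Finset.card_lt_card (Finset.filter_ssubset.mpr ⟨_, Finset.max'_mem _ h.2, by simp⟩)

variable {K : Type*} [Field K] [NeZero n]

/-- The exponent vector of `x_F (u' / x_{F^{(u)}})` with `u' = u / x_{max(u)}`. The division is
exact whenever the accompanying wedge product `e_{σ ∖ F} ∧ e_{F^{(u)}} ∧ e_{max(u)}` is nonzero. -/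
def cycleCoeff (u : Fin n →₀ ℕ) (F : Finset (Fin n)) : Fin n →₀ ℕ :=
  (∑ k ∈ F, Finsupp.single k 1) +
    ((u - Finsupp.single (maxVar u) 1) - ∑ k ∈ F, Finsupp.single (nextVar u k) 1)

/-- The element
`e(u; σ) = ∑_{F ⊆ σ} (-1)^{u(σ; F)} ε(x_F (u' / x_{F^{(u)}})) e_{σ ∖ F} ∧ e_{F^{(u)}} ∧ e_{max(u)}`
of the Koszul complex of `S ⧸ I`, where `ε : S → S ⧸ I` is the canonical map. -/
def cycleE (I : Ideal (MvPolynomial (Fin n) K)) (u : Fin n →₀ ℕ) (σ : Finset (Fin n)) :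
    ExteriorAlgebra (MvPolynomial (Fin n) K ⧸ I) (Fin n → MvPolynomial (Fin n) K ⧸ I) :=
  ∑ F ∈ σ.powerset, (-1 : MvPolynomial (Fin n) K ⧸ I) ^ signExp u σ F •
    Ideal.Quotient.mk I (monomial (cycleCoeff u F) (1 : K)) •
      (koszulWedge _ ((σ \ F).sort (· ≤ ·)) *
        koszulWedge _ ((F.sort (· ≤ ·)).map (nextVar u)) * koszulE _ (maxVar u))

/-- The sequence `x = x_1, …, x_n` in `S ⧸ I`. -/
def varSeq (I : Ideal (MvPolynomial (Fin n) K)) (j : Fin n) : MvPolynomial (Fin n) K ⧸ I :=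
  Ideal.Quotient.mk I (X j)

/-- The index set of the `e(u; σ)` in homological degree `i`: the pairs `(u, σ)` with `u ∈ G(I)`,
`σ ⊆ [max(u) - 1] ∖ supp_t(u)` and `|σ| = i - 1`. -/
abbrev CycleIndex {d : ℕ} (t : Fin (d - 1) → ℕ) (I : Ideal (MvPolynomial (Fin n) K)) (i : ℕ) :
    Type :=
  {p : (Fin n →₀ ℕ) × Finset (Fin n) //
    p.1 ∈ minGens I ∧ p.2 ⊆ freeVars t p.1 ∧ p.2.card = i - 1}

end Cycles

end

end VectorSpread

/-!
Let `S = K[x_1, …, x_n]`, and let `Λ` be its Koszul complex with `K`-basis the cells `x^b e_A`. Since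
`Λ` is exact in positive degrees, lifting a cycle of `Λ / IΛ` to `Λ` and applying `∂` identifies
`H_i(x; S/I)` with the homology of `IΛ` in degree `i - 1`. The proof computes the latter and shows that
the boundaries of the evident lifts of the `e(u; σ)` form a basis of it.

*The cycles.* The substitution `e_j ↦ x_j e_j` embeds `Λ` into the Koszul complex of the sequence
`1, …, 1`. There the lift of `e(u; σ)` becomes `x^u x_σ ∏_{k ∈ σ} (e_k - e_{k^{(u)}}) ∧ e_{max(u)}`; the
recursive signs are those of the expansion of this product (`prod_koszulE_sub`). The factors
`e_k - e_{k^{(u)}}` are cycles for the sequence `1, …, 1`, so the boundary of the lift is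
`±∑_F ± x_F (u / x_{F^{(u)}}) e_{σ ∖ F} ∧ e_{F^{(u)}}` (`koszulD_polyCycle`). Its coefficients belong to
`I`, because for `F ⊆ σ` the monomial `x_F (u / x_{F^{(u)}})` arises from `u` by exchanges that keep it
`t`-spread (`isSpread_exchange`).

*The decomposition of `I`.* Assign to a monomial of `I` its lexicographically largest divisor in
`G(I)`. The monomials assigned to `u` are exactly the `u w` such that no variable of
`[max(u) - 1] ∖ supp_t(u)` divides `w` (`notMem_freeVars_of_max`, `toLex_le_of_free`). Both this and
the fact that the terms with `F` nonempty above belong to lexicographically larger generators rest on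
the observation that every `t`-spread monomial of `I` has an initial segment in `G(I)`
(`exists_initial_minGens`).

*The cycles of `IΛ`.* Within the piece of `u` a cell `x^u x^w e_A` has as active variables those of `w`
and `A` that are not free for `u`. Replacing `e_j` by `x_j` for the first active variable `j` is a
matching of the cells, and the unmatched cells are the `x^u e_σ` with `σ ⊆ [max(u) - 1] ∖ supp_t(u)`,
the leading terms of the boundaries of the lifts. Triangularity with respect to the order of the
pieces shows that these boundaries together with the boundaries of `IΛ` span all cycles of `IΛ`
(`StanleyDecomposition.mem_sup_of_cycle`). The same argument with the single piece `S` gives the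
exactness of `Λ` (`exists_polyD_eq`).

*Independence.* By the minimality of `u ∈ G(I)`, no cell `x^u e_σ` occurs in a boundary of `IΛ`
(`repr_polyD_eq_zero_of_minGens`), whereas the boundaries of the lifts are triangular in these cells
with respect to the weight `∑ j u_j` (`eq_zero_of_sum_mem_koszulBoundaries`).
-/

namespace VectorSpread

noncomputable section

/-! ### Wedge products, their basis, and the Koszul differential -/

section Wedge

variable (R : Type*) [CommRing R] {m : ℕ}

theorem koszulWedge_nil : koszulWedge R ([] : List (Fin m)) = 1 := rfl

theorem koszulWedge_cons (a : Fin m) (L : List (Fin m)) :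
    koszulWedge R (a :: L) = koszulE R a * koszulWedge R L := by
  simp [koszulWedge]

theorem koszulWedge_append (L L' : List (Fin m)) :
    koszulWedge R (L ++ L') = koszulWedge R L * koszulWedge R L' := by
  simp [koszulWedge]

theorem koszulWedge_singleton (a : Fin m) : koszulWedge R [a] = koszulE R a := by
  simp [koszulWedge]

theorem koszulE_mul_self (a : Fin m) : koszulE R a * koszulE R a = 0 :=
  ExteriorAlgebra.ι_sq_zero _

theorem koszulE_mul_koszulE (a b : Fin m) :
    koszulE R a * koszulE R b = -(koszulE R b * koszulE R a) := by
  rw [eq_neg_iff_add_eq_zero]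
  exact ExteriorAlgebra.ι_add_mul_swap _ _

theorem koszulWedge_perm {L L' : List (Fin m)} (h : L.Perm L') :
    ∃ s : ℕ, koszulWedge R L = (-1 : R) ^ s • koszulWedge R L' := by
  induction h with
  | nil => exact ⟨0, by simp⟩
  | cons x _ ih =>
    obtain ⟨s, hs⟩ := ih
    exact ⟨s, by rw [koszulWedge_cons, koszulWedge_cons, hs, mul_smul_comm]⟩
  | swap x y l =>
    refine ⟨1, ?_⟩
    simp only [koszulWedge_cons, ← mul_assoc]
    rw [koszulE_mul_koszulE R y x]
    simp
  | trans _ _ ih₁ ih₂ =>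
    obtain ⟨s, hs⟩ := ih₁
    obtain ⟨s', hs'⟩ := ih₂
    exact ⟨s + s', by rw [hs, hs', smul_smul, pow_add]⟩

theorem koszulWedge_eq_zero {L : List (Fin m)} (h : ¬ L.Nodup) : koszulWedge R L = 0 := by
  rw [← List.exists_duplicate_iff_not_nodup] at h
  obtain ⟨x, hx⟩ := h
  rw [List.duplicate_iff_sublist] at hx
  obtain ⟨L', hL'⟩ := hx.exists_perm_append
  obtain ⟨s, hs⟩ := koszulWedge_perm R hL'
  rw [hs, koszulWedge_append, koszulWedge_cons, koszulWedge_singleton, koszulE_mul_self, zero_mul,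
    smul_zero]

/-- Up to sign, the wedge product along a list without repetitions is the one along the
increasing list of its entries. -/
theorem koszulWedge_eq_sort {L : List (Fin m)} (h : L.Nodup) :
    ∃ s : ℕ, koszulWedge R L = (-1 : R) ^ s • koszulWedge R (L.toFinset.sort (· ≤ ·)) := by
  refine koszulWedge_perm R ?_
  refine (List.perm_ext_iff_of_nodup h (Finset.sort_nodup _ _)).mpr fun a => ?_
  simp

theorem koszulWedge_mul_koszulE (L : List (Fin m)) (a : Fin m) :
    koszulWedge R L * koszulE R a = (-1 : R) ^ L.length • (koszulE R a * koszulWedge R L) := by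
  induction L with
  | nil => simp [koszulWedge_nil]
  | cons b L ih =>
    rw [koszulWedge_cons, mul_assoc, ih, mul_smul_comm, ← mul_assoc, koszulE_mul_koszulE,
      neg_mul, mul_assoc, List.length_cons, pow_succ]
    simp

/-- The basis of the exterior algebra formed by the `e_A`, `A ⊆ [m]`. -/
def wedgeBasis (m : ℕ) : Module.Basis (Finset (Fin m)) R (ExteriorAlgebra R (Fin m → R)) :=
  (Pi.basisFun R (Fin m)).ExteriorAlgebra

theorem ιMulti_family_eq_koszulWedge {i : ℕ} (s : Set.powersetCard (Fin m) i) :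
    ExteriorAlgebra.ιMulti_family R i (Pi.basisFun R (Fin m)) s
      = koszulWedge R (s.1.sort (· ≤ ·)) := by
  rw [ExteriorAlgebra.ιMulti_family, ExteriorAlgebra.ιMulti_apply, koszulWedge]
  congr 1
  rw [← Finset.listMap_orderEmbOfFin_finRange s.1 s.2, List.map_map, List.ofFn_eq_map]
  refine List.map_congr_left fun a _ => ?_
  simp [koszulE, Set.powersetCard.ofFinEmbEquiv_symm_apply]

theorem wedgeBasis_apply (A : Finset (Fin m)) :
    wedgeBasis R m A = koszulWedge R (A.sort (· ≤ ·)) := by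
  rw [wedgeBasis, ExteriorAlgebra.basis_apply_ofCard _ rfl]
  exact ιMulti_family_eq_koszulWedge R ⟨A, rfl⟩

theorem exteriorPower_eq_span (i : ℕ) :
    ⋀[R]^i (Fin m → R) = Submodule.span R (wedgeBasis R m '' {A | A.card = i}) := by
  rw [← exteriorPower.ιMulti_family_span_fixedDegree_of_span R (v := Pi.basisFun R (Fin m))
    (Module.Basis.span_eq _)]
  congr 1
  ext x
  simp only [Set.mem_range, Set.mem_image, Set.mem_ofPred_eq, wedgeBasis_apply,
    ιMulti_family_eq_koszulWedge]
  constructor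
  · rintro ⟨s, rfl⟩; exact ⟨s.1, s.2, rfl⟩
  · rintro ⟨A, hA, rfl⟩; exact ⟨⟨A, hA⟩, rfl⟩

theorem mem_exteriorPower_iff {i : ℕ} {x : ExteriorAlgebra R (Fin m → R)} :
    x ∈ ⋀[R]^i (Fin m → R) ↔ ∀ A, (wedgeBasis R m).repr x A ≠ 0 → A.card = i := by
  rw [exteriorPower_eq_span, Module.Basis.mem_span_image]
  simp [Set.subset_def]

theorem koszulWedge_mem (L : List (Fin m)) :
    koszulWedge R L ∈ ⋀[R]^L.length (Fin m → R) := by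
  induction L with
  | nil => exact Submodule.mem_one.mpr ⟨1, map_one _⟩
  | cons a L ih =>
    rw [koszulWedge_cons, List.length_cons]
    change _ ∈ LinearMap.range (ExteriorAlgebra.ι R) ^ (_ + 1)
    rw [pow_succ']
    exact Submodule.mul_mem_mul (LinearMap.mem_range_self _ _) ih

theorem koszulD_koszulWedge (f : Fin m → R) {L : List (Fin m)} (h : L.Nodup) :
    ∃ s : Fin m → ℕ, koszulD f (koszulWedge R L)
      = ∑ j ∈ L.toFinset, (-1 : R) ^ s j • f j • koszulWedge R (L.erase j) := by
  induction L with
  | nil => exact ⟨0, by simp [koszulWedge_nil, koszulD_one]⟩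
  | cons a L ih =>
    rw [List.nodup_cons] at h
    obtain ⟨s, hs⟩ := ih h.2
    have hne : ∀ j ∈ L.toFinset, j ≠ a := by
      rintro j hj rfl; exact h.1 (List.mem_toFinset.mp hj)
    refine ⟨fun j => if j = a then 0 else s j + 1, ?_⟩
    rw [koszulWedge_cons, koszulD_koszulE_mul, hs, List.toFinset_cons,
      Finset.sum_insert (by simpa using h.1), Finset.mul_sum, sub_eq_add_neg,
      ← Finset.sum_neg_distrib]
    congr 1
    · simp
    · refine Finset.sum_congr rfl fun j hj => ?_
      simp only [if_neg (hne j hj)]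
      rw [List.erase_cons_tail (by simpa using (hne j hj).symm),
        koszulWedge_cons, pow_succ]
      simp

/-- `∂ e_A = ∑_{j ∈ A} ± f_j e_{A ∖ j}`. -/
theorem koszulD_wedgeBasis (f : Fin m → R) (A : Finset (Fin m)) :
    ∃ s : Fin m → ℕ, koszulD f (wedgeBasis R m A)
      = ∑ j ∈ A, (-1 : R) ^ s j • f j • wedgeBasis R m (A.erase j) := by
  obtain ⟨s, hs⟩ := koszulD_koszulWedge R f (A.sort_nodup (· ≤ ·))
  refine ⟨s, ?_⟩
  rw [wedgeBasis_apply, hs, Finset.sort_toFinset]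
  refine Finset.sum_congr rfl fun j hj => ?_
  rw [wedgeBasis_apply]
  congr 3
  refine List.Perm.eq_of_sortedLE ?_ (Finset.sortedLT_sort _).sortedLE ?_
  · exact (List.Pairwise.sublist List.erase_sublist (Finset.pairwise_sort A (· ≤ ·))).sortedLE
  · refine (List.perm_ext_iff_of_nodup ((Finset.sort_nodup _ _).erase _)
      (Finset.sort_nodup _ _)).mpr fun a => ?_
    simp [List.Nodup.mem_erase_iff (Finset.sort_nodup A (· ≤ ·))]

end Wedge

/-! ### Rescaling the basis elements -/

section Scale

variable {R : Type*} [CommRing R] {m : ℕ}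

/-- The algebra endomorphism of the exterior algebra with `e_j ↦ f_j e_j`. It intertwines the Koszul
differential of `f` with that of the sequence `1, …, 1`. -/
def koszulScale (f : Fin m → R) :
    ExteriorAlgebra R (Fin m → R) →ₐ[R] ExteriorAlgebra R (Fin m → R) :=
  ExteriorAlgebra.map (LinearMap.pi fun j => f j • LinearMap.proj j)

theorem koszulScale_koszulE (f : Fin m → R) (j : Fin m) :
    koszulScale f (koszulE R j) = f j • koszulE R j := by
  rw [koszulE, koszulScale, ExteriorAlgebra.map_apply_ι, ← map_smul]
  congr 1
  ext i
  by_cases h : i = j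
  · subst h; simp
  · simp [h]

theorem koszulScale_koszulWedge (f : Fin m → R) (L : List (Fin m)) :
    koszulScale f (koszulWedge R L) = (L.map f).prod • koszulWedge R L := by
  induction L with
  | nil => simp [koszulWedge_nil]
  | cons a L ih =>
    rw [koszulWedge_cons, map_mul, koszulScale_koszulE, ih, smul_mul_smul_comm, List.map_cons,
      List.prod_cons]

theorem koszulWedge_induction {p : ExteriorAlgebra R (Fin m → R) → Prop}
    (wedge : ∀ L, p (koszulWedge R L)) (add : ∀ x y, p x → p y → p (x + y))
    (smul : ∀ (r : R) x, p x → p (r • x)) (x : ExteriorAlgebra R (Fin m → R)) : p x := by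
  have hx := (wedgeBasis R m).mem_span x
  induction hx using Submodule.span_induction with
  | mem x h => obtain ⟨A, rfl⟩ := h; rw [wedgeBasis_apply]; exact wedge _
  | zero => simpa using smul 0 _ (wedge [])
  | add x y _ _ hx hy => exact add _ _ hx hy
  | smul r x _ hx => exact smul _ _ hx

theorem koszulScale_koszulD (f : Fin m → R) (x : ExteriorAlgebra R (Fin m → R)) :
    koszulScale f (koszulD f x) = koszulD 1 (koszulScale f x) := by
  induction x using koszulWedge_induction with
  | wedge L =>
    induction L with
    | nil => simp [koszulWedge_nil, koszulD_one]
    | cons a L ih =>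
      rw [koszulWedge_cons, koszulD_koszulE_mul, map_sub, map_mul, ih, map_smul, map_mul,
        koszulScale_koszulE, smul_mul_assoc, smul_mul_assoc, map_smul, koszulD_koszulE_mul,
        smul_sub]
      simp
  | add x y hx hy => simp only [map_add, hx, hy]
  | smul r x hx => simp only [map_smul, hx]

theorem koszulScale_injective [IsDomain R] {f : Fin m → R} (hf : ∀ j, f j ≠ 0) :
    Function.Injective (koszulScale f) := by
  rw [injective_iff_map_eq_zero]
  intro x hx
  have key : ∀ y A, (wedgeBasis R m).repr (koszulScale f y) A
      = (∏ j ∈ A, f j) * (wedgeBasis R m).repr y A := by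
    intro y A
    rw [← (wedgeBasis R m).sum_repr y]
    simp only [map_sum, map_smul, wedgeBasis_apply R, koszulScale_koszulWedge,
      Finsupp.finsetSum_apply]
    simp only [← wedgeBasis_apply R, Module.Basis.repr_self, Finsupp.smul_apply, smul_eq_mul,
      Finset.mul_sum]
    refine Finset.sum_congr rfl fun B _ => ?_
    by_cases h : B = A
    · subst h
      have : ((B.sort (· ≤ ·)).map f).prod = ∏ j ∈ B, f j := by
        rw [← List.prod_toFinset f (Finset.sort_nodup _ _), Finset.sort_toFinset]
      rw [this]; ring
    · simp [h]
  apply (wedgeBasis R m).ext_elem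
  intro A
  have := key x A
  rw [hx] at this
  simp only [map_zero, Finsupp.coe_zero, Pi.zero_apply] at this ⊢
  exact (mul_eq_zero.mp this.symm).resolve_left (Finset.prod_ne_zero_iff.mpr fun j _ => hf j)

end Scale

/-! ### Change of coefficients -/

section BaseChange

variable {R : Type*} [CommRing R] {m : ℕ} (R' : Type*) [CommRing R'] [Algebra R R']

/-- The change of coefficients `e_j ↦ e_j` to an `R`-algebra `R'`. -/
def koszulBaseChange : ExteriorAlgebra R (Fin m → R) →ₐ[R] ExteriorAlgebra R' (Fin m → R') :=
  ExteriorAlgebra.lift R ⟨((ExteriorAlgebra.ι R').restrictScalars R).comp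
    ((Algebra.linearMap R R').compLeft (Fin m)), by
      intro v
      rw [LinearMap.comp_apply, LinearMap.restrictScalars_apply, ExteriorAlgebra.ι_sq_zero]⟩

theorem koszulBaseChange_koszulE (j : Fin m) :
    koszulBaseChange R' (koszulE R j) = koszulE R' j := by
  rw [koszulE, koszulBaseChange, ExteriorAlgebra.lift_ι_apply]
  simp only [LinearMap.coe_comp, LinearMap.coe_restrictScalars, Function.comp_apply, koszulE]
  congr 1
  ext i
  by_cases h : i = j
  · subst h; simp
  · simp [h]

theorem koszulBaseChange_koszulWedge (L : List (Fin m)) :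
    koszulBaseChange R' (koszulWedge R L) = koszulWedge R' L := by
  rw [koszulWedge, map_list_prod, List.map_map, koszulWedge]
  congr 1
  exact List.map_congr_left fun a _ => koszulBaseChange_koszulE R' a

theorem koszulBaseChange_koszulD (f : Fin m → R) (x : ExteriorAlgebra R (Fin m → R)) :
    koszulBaseChange R' (koszulD f x)
      = koszulD (fun j => algebraMap R R' (f j)) (koszulBaseChange R' x) := by
  have hs : ∀ (r : R) (y : ExteriorAlgebra R' (Fin m → R')), r • y = algebraMap R R' r • y :=
    fun r y => (algebraMap_smul R' r y).symm
  induction x using koszulWedge_induction with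
  | wedge L =>
    induction L with
    | nil => simp [koszulWedge_nil, koszulD_one]
    | cons a L ih =>
      rw [koszulWedge_cons, koszulD_koszulE_mul, map_sub, map_mul, ih, map_smul, map_mul,
        koszulBaseChange_koszulE, koszulD_koszulE_mul, hs]
  | add x y hx hy => simp only [map_add, hx, hy]
  | smul r x hx => rw [map_smul, map_smul, map_smul, hx, hs, hs, map_smul]

theorem wedgeBasis_repr_koszulBaseChange (x : ExteriorAlgebra R (Fin m → R))
    (A : Finset (Fin m)) :
    (wedgeBasis R' m).repr (koszulBaseChange R' x) A
      = algebraMap R R' ((wedgeBasis R m).repr x A) := by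
  have hs : ∀ (r : R) (y : ExteriorAlgebra R' (Fin m → R')), r • y = algebraMap R R' r • y :=
    fun r y => (algebraMap_smul R' r y).symm
  conv_lhs => rw [← (wedgeBasis R m).sum_repr x]
  simp only [map_sum, map_smul, wedgeBasis_apply R, koszulBaseChange_koszulWedge,
    ← wedgeBasis_apply R', hs, Module.Basis.repr_self, Finsupp.finsetSum_apply,
    Finsupp.smul_apply, Finsupp.single_apply, smul_eq_mul]
  simp

theorem exists_koszulBaseChange_eq (h : Function.Surjective (algebraMap R R'))
    {i : ℕ} {y : ExteriorAlgebra R' (Fin m → R')} (hy : y ∈ ⋀[R']^i (Fin m → R')) :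
    ∃ x ∈ ⋀[R]^i (Fin m → R), koszulBaseChange R' x = y := by
  classical
  choose g hg using h
  refine ⟨∑ A, (if A.card = i then g ((wedgeBasis R' m).repr y A) else 0) • wedgeBasis R m A,
    Submodule.sum_mem _ fun A _ => ?_, ?_⟩
  · split_ifs with hA
    · refine Submodule.smul_mem _ _ ?_
      rw [exteriorPower_eq_span]
      exact Submodule.subset_span ⟨A, hA, rfl⟩
    · simp
  · apply (wedgeBasis R' m).ext_elem
    intro A
    rw [wedgeBasis_repr_koszulBaseChange]
    simp only [map_sum, map_smul, Module.Basis.repr_self, Finsupp.finsetSum_apply,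
      Finsupp.smul_apply, Finsupp.single_apply, smul_eq_mul]
    rw [Finset.sum_eq_single A (fun B _ hB => by simp [hB]) (by simp), if_pos rfl, mul_one,
      apply_ite (algebraMap R R'), hg, map_zero]
    split_ifs with hA
    · rfl
    · by_contra h0
      exact hA ((mem_exteriorPower_iff R').mp hy A (Ne.symm h0))

end BaseChange

/-! ### Successors in the support -/

section NextVar

variable {n : ℕ}

theorem maxVar_mem [NeZero n] {u : Fin n →₀ ℕ} (hu : u ≠ 0) : maxVar u ∈ u.support := by
  have h : u.support.Nonempty := Finsupp.support_nonempty_iff.mpr hu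
  rw [maxVar, dif_pos h]
  exact Finset.max'_mem _ _

theorem le_maxVar [NeZero n] {u : Fin n →₀ ℕ} {j : Fin n} (hj : j ∈ u.support) :
    j ≤ maxVar u := by
  rw [maxVar, dif_pos ⟨j, hj⟩]
  exact Finset.le_max' _ _ hj

variable {u : Fin n →₀ ℕ}

theorem nextVar_spec {k j : Fin n} (hj : j ∈ u.support) (hk : k < j) :
    nextVar u k ∈ u.support ∧ k < nextVar u k := by
  have h : (u.support.filter fun j => k < j).Nonempty := ⟨j, Finset.mem_filter.mpr ⟨hj, hk⟩⟩
  rw [nextVar, dif_pos h]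
  exact Finset.mem_filter.mp (Finset.min'_mem _ h)

theorem nextVar_le {k j : Fin n} (hj : j ∈ u.support) (hk : k < j) : nextVar u k ≤ j := by
  have h : j ∈ u.support.filter fun j => k < j := Finset.mem_filter.mpr ⟨hj, hk⟩
  rw [nextVar, dif_pos ⟨j, h⟩]
  exact Finset.min'_le _ _ h

theorem nextVar_eq {k j : Fin n} (hj : j ∈ u.support) (hk : k < j)
    (h : ∀ i ∈ u.support, k < i → j ≤ i) : nextVar u k = j :=
  le_antisymm (nextVar_le hj hk) (h _ (nextVar_spec hj hk).1 (nextVar_spec hj hk).2)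

theorem nextVar_mono {k l j : Fin n} (hj : j ∈ u.support) (hl : l < j) (hkl : k ≤ l) :
    nextVar u k ≤ nextVar u l :=
  nextVar_le (nextVar_spec hj hl).1 (hkl.trans_lt (nextVar_spec hj hl).2)

end NextVar

/-! ### The signs of the cycles -/

section SortMax

variable {n : ℕ}

theorem max'_insert_of_lt {k : Fin n} {σ : Finset (Fin n)} (h : ∀ r ∈ σ, r < k)
    (hne : (insert k σ).Nonempty) : (insert k σ).max' hne = k := by
  refine le_antisymm (Finset.max'_le _ _ _ fun r hr => ?_)
    (Finset.le_max' _ _ (Finset.mem_insert_self _ _))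
  rcases Finset.mem_insert.mp hr with rfl | hr
  · exact le_rfl
  · exact (h r hr).le

theorem sort_insert_of_lt {k : Fin n} {σ : Finset (Fin n)} (h : ∀ r ∈ σ, r < k) :
    (insert k σ).sort (· ≤ ·) = σ.sort (· ≤ ·) ++ [k] := by
  have hk : k ∉ σ := fun hk => lt_irrefl _ (h k hk)
  refine List.Perm.eq_of_sortedLE (Finset.sortedLT_sort _).sortedLE ?_ ?_
  · refine List.Pairwise.sortedLE (List.pairwise_append.mpr
      ⟨Finset.pairwise_sort σ (· ≤ ·), List.pairwise_singleton _ _, ?_⟩)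
    intro a ha b hb
    rw [List.mem_singleton.mp hb]
    exact (h a ((Finset.mem_sort _).mp ha)).le
  · refine (List.perm_ext_iff_of_nodup (Finset.sort_nodup _ _) ?_).mpr fun a => ?_
    · refine List.nodup_append.mpr ⟨Finset.sort_nodup _ _, List.nodup_singleton _, ?_⟩
      intro a ha b hb
      rw [List.mem_singleton.mp hb]
      exact (h a ((Finset.mem_sort _).mp ha)).ne
    · simp [or_comm]

end SortMax

section SignExp

variable {n : ℕ} (u : Fin n →₀ ℕ)

theorem signExp_empty (σ : Finset (Fin n)) : signExp u σ ∅ = 0 := by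
  rw [signExp]
  simp

theorem signExp_insert_of_notMem {k : Fin n} {σ F : Finset (Fin n)} (h : ∀ r ∈ σ, r < k)
    (hF : k ∉ F) : signExp u (insert k σ) F = signExp u σ F + F.card := by
  have hk : k ∉ σ := fun hk => lt_irrefl _ (h k hk)
  rcases F.eq_empty_or_nonempty with rfl | hne
  · simp [signExp_empty]
  · rw [signExp, dif_pos ⟨hne, Finset.insert_nonempty _ _⟩]
    simp only [max'_insert_of_lt h]
    rw [if_pos hF, Finset.erase_insert hk]

theorem signExp_insert_insert {k : Fin n} {σ F : Finset (Fin n)} (h : ∀ r ∈ σ, r < k)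
    (hF : F ⊆ σ) : signExp u (insert k σ) (insert k F)
      = signExp u (σ.filter fun r => nextVar u r ≠ nextVar u k)
          (F.filter fun r => nextVar u r ≠ nextVar u k)
        + (σ.filter fun r => nextVar u r = nextVar u k).card * (F.card + 2) + 1 := by
  have hk : k ∉ σ := fun hk => lt_irrefl _ (h k hk)
  rw [signExp, dif_pos ⟨Finset.insert_nonempty _ _, Finset.insert_nonempty _ _⟩]
  simp only [max'_insert_of_lt h]
  rw [if_neg (by simp), Finset.filter_insert, if_neg (by simp), Finset.filter_insert,
    if_neg (by simp), Finset.filter_insert, if_pos rfl, Finset.card_insert_of_notMem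
    (by simp [hk]), Finset.card_insert_of_notMem (fun h => hk (hF h))]
  simp [add_assoc]

/-- The elements of a set `T` above `σ` and disjoint from `F` contribute `|F|` each to the sign
exponent. -/
theorem signExp_union {σ T F : Finset (Fin n)} (h : ∀ r ∈ σ, ∀ s ∈ T, r < s)
    (hF : Disjoint T F) : signExp u (σ ∪ T) F = signExp u σ F + T.card * F.card := by
  induction T using Finset.induction_on_max with
  | empty => simp
  | insert k T hk ih =>
    have hkT : k ∉ T := fun h => lt_irrefl _ (hk k h)
    rw [Finset.disjoint_insert_left] at hF
    rw [Finset.union_insert, signExp_insert_of_notMem u _ hF.1,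
      ih (fun r hr s hs => h r hr s (Finset.mem_insert_of_mem hs)) hF.2,
      Finset.card_insert_of_notMem hkT]
    · ring
    · intro r hr
      rcases Finset.mem_union.mp hr with hr | hr
      · exact h r hr k (Finset.mem_insert_self _ _)
      · exact hk r hr

variable {u} in
/-- If no element of `F ⊆ σ` has the same successor in `supp(u)` as `k > max σ`, then adding `k` to
both sets changes the parity of the sign exponent. -/
theorem neg_one_pow_signExp_insert_insert (R : Type*) [CommRing R] {k j : Fin n}
    {σ F : Finset (Fin n)}
    (hj : j ∈ u.support) (hk : k < j) (h : ∀ r ∈ σ, r < k) (hF : F ⊆ σ)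
    (hd : ∀ r ∈ F, nextVar u r ≠ nextVar u k) :
    (-1 : R) ^ signExp u (insert k σ) (insert k F) = -(-1) ^ signExp u σ F := by
  have h1 : σ = (σ.filter fun r => nextVar u r ≠ nextVar u k) ∪
      σ.filter fun r => nextVar u r = nextVar u k := by
    rw [Finset.union_comm, Finset.filter_union_filter_not_eq]
  have h2 : signExp u σ F = signExp u (σ.filter fun r => nextVar u r ≠ nextVar u k) F
      + (σ.filter fun r => nextVar u r = nextVar u k).card * F.card := by
    conv_lhs => rw [h1]
    refine signExp_union u ?_ ?_
    · intro r hr s hs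
      rw [Finset.mem_filter] at hr hs
      by_contra hrs
      push Not at hrs
      refine hr.2 (le_antisymm (nextVar_mono hj hk (h r hr.1).le) ?_)
      rw [← hs.2]
      exact nextVar_mono hj ((h r hr.1).trans hk) hrs
    · rw [Finset.disjoint_left]
      intro r hr hrF
      exact hd r hrF (Finset.mem_filter.mp hr).2
  rw [signExp_insert_insert u h hF, Finset.filter_true_of_mem hd, h2]
  rw [mul_add, ← add_assoc, pow_add, pow_add _ _ (_ * 2), pow_mul' _ _ 2]
  simp

variable {u} in
/-- The expansion `∏_{k ∈ σ} (e_k - e_{k^{(u)}}) = ∑_{F ⊆ σ} ± e_{σ ∖ F} ∧ e_{F^{(u)}}`, in which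
the signs are given by the recursively defined exponents. -/
theorem prod_koszulE_sub (R : Type*) [CommRing R] {j : Fin n} (hj : j ∈ u.support)
    (σ : Finset (Fin n)) (hσ : ∀ k ∈ σ, k < j) :
    ((σ.sort (· ≤ ·)).map fun k => koszulE R k - koszulE R (nextVar u k)).prod
      = ∑ F ∈ σ.powerset, (-1 : R) ^ signExp u σ F •
        (koszulWedge R ((σ \ F).sort (· ≤ ·)) *
          koszulWedge R ((F.sort (· ≤ ·)).map (nextVar u))) := by
  induction σ using Finset.induction_on_max with
  | empty => simp [signExp_empty, koszulWedge_nil]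
  | insert k σ hk ih =>
    have hkσ : k ∉ σ := fun h => lt_irrefl _ (hk k h)
    have hkj := hσ k (Finset.mem_insert_self _ _)
    rw [sort_insert_of_lt hk, List.map_append, List.prod_append,
      ih fun r hr => hσ r (Finset.mem_insert_of_mem hr), Finset.sum_powerset_insert hkσ,
      List.map_singleton, List.prod_singleton, mul_sub, sub_eq_add_neg, Finset.sum_mul,
      Finset.sum_mul, ← Finset.sum_neg_distrib]
    congr 1
    · refine Finset.sum_congr rfl fun F hF => ?_
      rw [Finset.mem_powerset] at hF
      have hkF : k ∉ F := fun h => hkσ (hF h)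
      rw [signExp_insert_of_notMem u hk hkF, Finset.insert_sdiff_of_notMem _ hkF,
        sort_insert_of_lt fun r hr => hk r (Finset.sdiff_subset hr), koszulWedge_append,
        koszulWedge_singleton, smul_mul_assoc, mul_assoc, koszulWedge_mul_koszulE,
        List.length_map, Finset.length_sort, mul_smul_comm, smul_smul, ← pow_add, mul_assoc]
    · refine Finset.sum_congr rfl fun F hF => ?_
      rw [Finset.mem_powerset] at hF
      have hkF : k ∉ F := fun h => hkσ (hF h)
      rw [Finset.insert_sdiff_insert, Finset.sdiff_insert_of_notMem hkσ,
        sort_insert_of_lt fun r hr => hk r (hF hr), List.map_append, koszulWedge_append,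
        List.map_singleton, koszulWedge_singleton, smul_mul_assoc, mul_assoc]
      by_cases hd : ∀ r ∈ F, nextVar u r ≠ nextVar u k
      · rw [neg_one_pow_signExp_insert_insert R hj hkj hk hF hd, neg_smul]
      · push Not at hd
        obtain ⟨r, hr, hrk⟩ := hd
        have : koszulWedge R ((F.sort (· ≤ ·)).map (nextVar u)) * koszulE R (nextVar u k) = 0 := by
          rw [← koszulWedge_singleton, ← koszulWedge_append]
          refine koszulWedge_eq_zero R fun hnd => ?_
          refine (List.nodup_append.mp hnd).2.2 (nextVar u r) ?_ (nextVar u k) (by simp) hrk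
          exact List.mem_map_of_mem ((Finset.mem_sort _).mpr hr)
        rw [this]
        simp

/-- Every `e_k - e_{g k}` is a cycle for the sequence `1, …, 1`, so multiplication by a product of
such elements commutes with the differential up to sign. -/
theorem koszulD_prod_sub (R : Type*) [CommRing R] (g : Fin n → Fin n) (L : List (Fin n))
    (b : ExteriorAlgebra R (Fin n → R)) :
    koszulD 1 ((L.map fun k => koszulE R k - koszulE R (g k)).prod * b)
      = (-1 : R) ^ L.length • ((L.map fun k => koszulE R k - koszulE R (g k)).prod *
          koszulD 1 b) := by
  induction L with
  | nil => simp
  | cons a L ih =>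
    rw [List.map_cons, List.prod_cons, mul_assoc, sub_mul, map_sub, koszulD_koszulE_mul,
      koszulD_koszulE_mul, ih, List.length_cons, pow_succ, mul_assoc, sub_mul]
    simp only [Pi.one_apply, mul_smul_comm, mul_neg, mul_one, neg_smul, smul_sub]
    abel

end SignExp

/-! ### Exchanges in vector-spread monomials -/

section Positions

variable {n : ℕ}

theorem getElem_le_iff_lt_countP {α : Type*} [LinearOrder α] {L : List α}
    (hL : L.Pairwise (· ≤ ·)) (k : α) {p : ℕ} (hp : p < L.length) :
    L[p] ≤ k ↔ p < L.countP (· ≤ k) := by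
  induction L generalizing p with
  | nil => simp at hp
  | cons a L ih =>
    rw [List.pairwise_cons] at hL
    by_cases hak : a ≤ k
    · rw [List.countP_cons_of_pos (by simpa using hak)]
      cases p with
      | zero => simpa using hak
      | succ p =>
        rw [List.getElem_cons_succ, ih hL.2]
        omega
    · have h0 : (a :: L).countP (· ≤ k) = 0 := by
        rw [List.countP_eq_zero]
        intro b hb
        rcases List.mem_cons.mp hb with rfl | hb
        · simpa using hak
        · simpa using (not_le.mp hak).trans_le (hL.1 b hb)
      rw [h0]
      refine iff_of_false (fun h => hak ?_) (Nat.not_lt_zero _)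
      cases p with
      | zero => simpa using h
      | succ p => exact (hL.1 _ (List.getElem_mem _)).trans h

/-- The number of variables of index at most `k`, counted with multiplicity, dividing `x^u`. -/
def countLe (u : Fin n →₀ ℕ) (k : Fin n) : ℕ := ∑ i ∈ Finset.Iic k, u i

theorem countLe_add (u v : Fin n →₀ ℕ) (k : Fin n) :
    countLe (u + v) k = countLe u k + countLe v k := by
  simp [countLe, Finset.sum_add_distrib]

theorem countLe_single (j k : Fin n) :
    countLe (Finsupp.single j 1) k = if j ≤ k then 1 else 0 := by
  simp [countLe, Finsupp.single_apply]

theorem countP_toMultiset (u : Fin n →₀ ℕ) (k : Fin n) :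
    (Finsupp.toMultiset u).countP (· ≤ k) = countLe u k := by
  induction u using Finsupp.induction_linear with
  | zero => simp [countLe]
  | add u v hu hv => rw [Finsupp.toMultiset_add, Multiset.countP_add, hu, hv, countLe_add]
  | single a c =>
    rw [Finsupp.toMultiset_single, Multiset.countP_nsmul]
    by_cases h : a ≤ k
    · rw [Multiset.countP_eq_card.mpr (by simpa using h)]
      simp [countLe, Finsupp.single_apply, h]
    · rw [Multiset.countP_eq_zero.mpr (by simpa using h)]
      simp [countLe, Finsupp.single_apply, h]

theorem length_factorList (u : Fin n →₀ ℕ) : (factorList u).length = u.degree := by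
  rw [factorList, Multiset.length_sort, Finsupp.card_toMultiset]
  rfl

theorem countLe_le_degree (u : Fin n →₀ ℕ) (k : Fin n) : countLe u k ≤ u.degree := by
  rw [Finsupp.degree_eq_sum]
  exact Finset.sum_le_sum_of_subset (Finset.subset_univ _)

/-- The `p`-th factor (counting from `0`) has index at most `k` if and only if more than `p` factors
do. -/
theorem factorList_getElem_le_iff (u : Fin n →₀ ℕ) (k : Fin n) {p : ℕ}
    (hp : p < (factorList u).length) : (factorList u)[p] ≤ k ↔ p < countLe u k := by
  have h : (factorList u).Pairwise (· ≤ ·) := Multiset.pairwise_sort _ _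
  rw [getElem_le_iff_lt_countP h, ← countP_toMultiset,
    ← Multiset.coe_countP]
  simp only [factorList, Multiset.sort_eq]

end Positions

section Swap

variable {n d : ℕ} {t : Fin (d - 1) → ℕ} {u : Fin n →₀ ℕ}

/-- The monomial `x_k (u / x_{k^{(u)}})`. -/
def swap (u : Fin n →₀ ℕ) (k : Fin n) : Fin n →₀ ℕ :=
  Finsupp.single k 1 + (u - Finsupp.single (nextVar u k) 1)

theorem single_le_of_mem_support {j : Fin n} (hj : j ∈ u.support) : Finsupp.single j 1 ≤ u := by
  rw [Finsupp.single_le_iff]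
  exact Nat.one_le_iff_ne_zero.mpr (Finsupp.mem_support_iff.mp hj)

theorem swap_add {j k : Fin n} (hj : j ∈ u.support) (hk : k < j) :
    swap u k + Finsupp.single (nextVar u k) 1 = u + Finsupp.single k 1 := by
  rw [swap, add_assoc, tsub_add_cancel_of_le (single_le_of_mem_support (nextVar_spec hj hk).1),
    add_comm]

theorem degree_swap {j k : Fin n} (hj : j ∈ u.support) (hk : k < j) :
    (swap u k).degree = u.degree := by
  have := congrArg Finsupp.degree (swap_add hj hk)
  simpa using this

theorem countLe_eq_of_lt_nextVar {i k : Fin n} (hki : k ≤ i) (hi : i < nextVar u k) :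
    countLe u i = countLe u k := by
  refine (Finset.sum_subset (Finset.Iic_subset_Iic.mpr hki) fun l hl hlk => ?_).symm
  rw [Finset.mem_Iic] at hl hlk
  by_contra h
  exact absurd (nextVar_le (Finsupp.mem_support_iff.mpr h) (not_le.mp hlk))
    (not_le.mpr (hl.trans_lt hi))

theorem swap_getElem {j k : Fin n} (hj : j ∈ u.support) (hk : k < j) {q : ℕ}
    (hq : q < (factorList (swap u k)).length) (hq' : q < (factorList u).length) :
    (factorList (swap u k))[q] = if q = countLe u k then k else (factorList u)[q] := by
  refine eq_of_forall_ge_iff fun i => ?_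
  rw [factorList_getElem_le_iff]
  have h := congrArg (fun v => countLe v i) (swap_add hj hk)
  simp only [countLe_add, countLe_single] at h
  have hs := (nextVar_spec hj hk).2
  have h3 : k ≤ i → i < nextVar u k → countLe u i = countLe u k := countLe_eq_of_lt_nextVar
  have h4 : i ≤ k → countLe u i ≤ countLe u k := fun h =>
    Finset.sum_le_sum_of_subset (Finset.Iic_subset_Iic.mpr h)
  have h5 : nextVar u k ≤ i → countLe u k < countLe u i := fun h => by
    refine Finset.sum_lt_sum_of_subset (Finset.Iic_subset_Iic.mpr (hs.le.trans h))
      (Finset.mem_Iic.mpr h) (by simpa using hs)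
      (Nat.pos_of_ne_zero (Finsupp.mem_support_iff.mp (nextVar_spec hj hk).1)) (by simp)
  have h6 := factorList_getElem_le_iff u i hq'
  by_cases h1 : k ≤ i <;> by_cases h2 : nextVar u k ≤ i
  · simp only [h1, h2, if_true] at h
    have := h5 h2
    split_ifs with hqc
    · simp only [h1, iff_true]; omega
    · rw [h6]; omega
  · simp only [h1, h2, if_true, if_false] at h
    have := h3 h1 (not_le.mp h2)
    split_ifs with hqc
    · simp only [h1, iff_true]; omega
    · rw [h6]; omega
  · exact absurd (hs.le.trans h2) h1
  · simp only [h1, h2, if_false] at h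
    have := h4 (not_le.mp h1).le
    split_ifs with hqc
    · simp only [h1, iff_false]; omega
    · rw [h6]; omega

theorem mem_spreadSupport {k : Fin n} : k ∈ spreadSupport t u ↔
    ∃ (i : Fin (d - 1)) (h : (i : ℕ) + 1 < (factorList u).length),
      ((factorList u)[(i : ℕ)] : ℕ) ≤ (k : ℕ) ∧
        (k : ℕ) < ((factorList u)[(i : ℕ)] : ℕ) + t i := by
  simp [spreadSupport]

theorem isSpread_swap (hu : IsSpread t u) {j k : Fin n} (hj : j ∈ u.support) (hk : k < j)
    (hks : k ∉ spreadSupport t u) : IsSpread t (swap u k) := by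
  have hlen : (factorList (swap u k)).length = (factorList u).length := by
    rw [length_factorList, length_factorList, degree_swap hj hk]
  refine ⟨hlen ▸ hu.1, fun i hi => ?_⟩
  have hi' : (i : ℕ) + 1 < (factorList u).length := hlen ▸ hi
  rw [swap_getElem hj hk _ (by omega), swap_getElem hj hk _ hi']
  have h0 := hu.2 i hi'
  by_cases h1 : (i : ℕ) = countLe u k
  · rw [if_pos h1, if_neg (by omega)]
    have : ¬ (factorList u)[(i : ℕ)] ≤ k := by
      rw [factorList_getElem_le_iff]; omega
    have := not_le.mp this
    rw [Fin.lt_def] at this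
    omega
  · rw [if_neg h1]
    by_cases h2 : (i : ℕ) + 1 = countLe u k
    · rw [if_pos h2]
      have h3 : (factorList u)[(i : ℕ)] ≤ k := by
        rw [factorList_getElem_le_iff]; omega
      by_contra h4
      exact hks (mem_spreadSupport.mpr ⟨i, hi', h3, not_le.mp h4⟩)
    · rwa [if_neg h2]

/-- Applying the exchange at `k` does not affect the `t`-spread support below `k`. -/
theorem notMem_spreadSupport_swap {j k f : Fin n} (hj : j ∈ u.support) (hk : k < j) (hf : f < k)
    (hfs : f ∉ spreadSupport t u) : f ∉ spreadSupport t (swap u k) := by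
  have hlen : (factorList (swap u k)).length = (factorList u).length := by
    rw [length_factorList, length_factorList, degree_swap hj hk]
  rw [mem_spreadSupport] at hfs ⊢
  rintro ⟨i, hi, h1, h2⟩
  have hi' : (i : ℕ) + 1 < (factorList u).length := hlen ▸ hi
  rw [swap_getElem hj hk _ (by omega)] at h1 h2
  split_ifs at h1 h2 with h3
  · exact absurd h1 (by simpa using hf)
  · exact hfs ⟨i, hi', h1, h2⟩

theorem nextVar_swap {j k f : Fin n} (hj : j ∈ u.support) (hk : k < j) (hf : f < k)
    (hne : nextVar u f ≠ nextVar u k) : nextVar (swap u k) f = nextVar u f := by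
  obtain ⟨h1, h2⟩ := nextVar_spec hj (hf.trans hk)
  obtain ⟨h3, h4⟩ := nextVar_spec hj hk
  have hle : nextVar u f ≤ k := by
    by_contra h
    exact hne (le_antisymm (nextVar_mono hj hk hf.le) (nextVar_le h1 (not_le.mp h)))
  have hval : ∀ i, i ≠ k → i ≠ nextVar u k → swap u k i = u i := by
    intro i hik hin
    simp [swap, hik.symm, hin.symm]
  refine nextVar_eq ?_ h2 fun i hi hfi => ?_
  · rw [Finsupp.mem_support_iff] at h1 ⊢
    rcases hle.eq_or_lt with h | h
    · rw [h]; simp [swap]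
    · rwa [hval _ h.ne hne]
  · by_cases hik : i = k
    · exact hik ▸ hle
    · by_cases hin : i = nextVar u k
      · exact hin ▸ hle.trans h4.le
      · rw [Finsupp.mem_support_iff, hval i hik hin] at hi
        exact nextVar_le (Finsupp.mem_support_iff.mpr hi) hfi

/-- If the `t`-spread monomial `x^v` agrees with `x^u` below `k` and has more factors `x_k`, then
`k` is not in the `t`-spread support of `u`. -/
theorem notMem_spreadSupport_of_lt {v : Fin n →₀ ℕ} {k : Fin n} (hu : IsSpread t u)
    (hv : IsSpread t v) (heq : ∀ i < k, u i = v i) (hlt : u k < v k) :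
    k ∉ spreadSupport t u := by
  rw [mem_spreadSupport]
  rintro ⟨q, hq, h1, h2⟩
  have hc : ∀ i < k, countLe u i = countLe v i := fun i hi =>
    Finset.sum_congr rfl fun l hl => heq l ((Finset.mem_Iic.mp hl).trans_lt hi)
  have hck : countLe u k < countLe v k := by
    refine Finset.sum_lt_sum (fun l hl => ?_) ⟨k, Finset.mem_Iic.mpr le_rfl, hlt⟩
    rcases (Finset.mem_Iic.mp hl).eq_or_lt with rfl | h
    · exact hlt.le
    · exact (heq l h).le
  have h3 : (q : ℕ) < countLe u k := (factorList_getElem_le_iff u k (by omega)).mp h1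
  have h4 : ¬ (q : ℕ) + 1 < countLe u k := by
    rw [← factorList_getElem_le_iff u k hq, Fin.le_def]
    have := hu.2 q hq
    omega
  have hqv : (q : ℕ) + 1 < (factorList v).length := by
    rw [length_factorList]
    exact lt_of_lt_of_le (by omega) (countLe_le_degree v k)
  have h5 : (factorList v)[(q : ℕ) + 1] ≤ k := by
    rw [factorList_getElem_le_iff]; omega
  have h6 : (factorList u)[(q : ℕ)] ≤ (factorList v)[(q : ℕ)] := by
    by_contra h
    rw [not_le] at h
    have h7 : (factorList v)[(q : ℕ)] < k := h.trans_le h1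
    have h8 := (factorList_getElem_le_iff v _ (by omega)).mp (le_refl (factorList v)[(q : ℕ)])
    rw [← hc _ h7, ← factorList_getElem_le_iff u _ (by omega)] at h8
    exact absurd h8 (not_le.mpr h)
  have h9 := hv.2 q hqv
  rw [Fin.le_def] at h5 h6
  omega

end Swap

/-! ### Minimal generators of vector-spread strongly stable ideals -/

section StronglyStable

variable {K : Type*} [Field K] {n d : ℕ} {t : Fin (d - 1) → ℕ}
  {I : Ideal (MvPolynomial (Fin n) K)}

theorem monomial_mem_of_le {u v : Fin n →₀ ℕ} (h : u ≤ v) (hu : monomial u (1 : K) ∈ I) :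
    monomial v (1 : K) ∈ I := by
  have : monomial v (1 : K) = monomial (v - u) 1 * monomial u 1 := by
    rw [monomial_mul, tsub_add_cancel_of_le h, one_mul]
  rw [this]
  exact I.mul_mem_left _ hu

theorem exists_minGens_le {v : Fin n →₀ ℕ} (hv : monomial v (1 : K) ∈ I) :
    ∃ u ∈ minGens I, u ≤ v := by
  obtain ⟨u, hu, hmin⟩ :=
    exists_minimal_le_of_wellFoundedLT (fun v => monomial v (1 : K) ∈ I) v hv
  exact ⟨u, hmin, hu⟩

theorem minGens_ne_zero (hI : I ≠ ⊤) {u : Fin n →₀ ℕ} (hu : u ∈ minGens I) : u ≠ 0 := by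
  rintro rfl
  exact hI ((Ideal.eq_top_iff_one I).mpr hu.1)

theorem finite_minGens (hI : IsSpreadIdeal t I) : (minGens I).Finite := by
  refine (Finsupp.finite_of_nat_weight_le (fun _ : Fin n => 1) (fun _ => one_ne_zero) d).subset
    fun u hu => ?_
  have h := (hI.2 u hu).1
  rw [length_factorList] at h
  simpa [Finsupp.weight_eq_sum, Finsupp.degree_eq_sum] using h

/-- The weight `∑ (j + 1) u_j` of a monomial, the variables being indexed from `0`. It decreases
both when a variable is replaced by an earlier one and when a variable is removed. -/
def indexWeight (u : Fin n →₀ ℕ) : ℕ := Finsupp.weight (fun j : Fin n => (j : ℕ) + 1) u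

theorem indexWeight_add (u v : Fin n →₀ ℕ) :
    indexWeight (u + v) = indexWeight u + indexWeight v := map_add _ _ _

theorem indexWeight_single (j : Fin n) : indexWeight (Finsupp.single j 1) = j + 1 := by
  rw [indexWeight, Finsupp.weight_single, one_smul]

theorem indexWeight_lt_of_lt {u v : Fin n →₀ ℕ} (h : u < v) : indexWeight u < indexWeight v := by
  obtain ⟨w, rfl⟩ := exists_add_of_le h.le
  have hw : w ≠ 0 := by rintro rfl; simp at h
  rw [indexWeight_add]
  obtain ⟨j, hj⟩ := Finsupp.ne_iff.mp hw
  have := Finsupp.le_weight_of_ne_zero' (fun j : Fin n => (j : ℕ) + 1) hj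
  have h2 : (j : ℕ) + 1 ≤ indexWeight w := this
  omega

variable [NeZero n]

theorem mem_freeVars {u : Fin n →₀ ℕ} {k : Fin n} :
    k ∈ freeVars t u ↔ k < maxVar u ∧ k ∉ spreadSupport t u := by
  simp [freeVars]

theorem monomial_swap_mem (hI : IsSpreadStronglyStable t I) {u : Fin n →₀ ℕ} (hu0 : u ≠ 0)
    (hu : IsSpread t u) (huI : monomial u (1 : K) ∈ I) {k : Fin n} (hk : k ∈ freeVars t u) :
    IsSpread t (swap u k) ∧ monomial (swap u k) (1 : K) ∈ I := by
  rw [mem_freeVars] at hk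
  have hs := isSpread_swap hu (maxVar_mem hu0) hk.1 hk.2
  obtain ⟨h1, h2⟩ := nextVar_spec (maxVar_mem hu0) hk.1
  exact ⟨hs, hI.2 u hu huI _ h1 _ h2 hs⟩

/-- Every `t`-spread monomial `v` of a `t`-spread strongly stable ideal has a minimal generator as
an initial segment: `v = x_{j_1} ⋯ x_{j_ℓ}` and `w = x_{j_1} ⋯ x_{j_r}` for some `r ≤ ℓ`. -/
theorem exists_initial_minGens (hI : IsSpreadStronglyStable t I) (htop : I ≠ ⊤)
    {v : Fin n →₀ ℕ} (hv : IsSpread t v) (hvI : monomial v (1 : K) ∈ I) :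
    ∃ w ∈ minGens I, w ≤ v ∧ ∀ i, w i < v i → ∀ j ∈ w.support, j ≤ i := by
  -- The initial segment is the `t`-spread divisor of `v` in `I` of least weight.
  obtain ⟨w, ⟨hw, hwI, hwv⟩, hmin⟩ := (measure (indexWeight (n := n))).wf.has_min
    {w | IsSpread t w ∧ monomial w (1 : K) ∈ I ∧ w ≤ v} ⟨v, hv, hvI, le_rfl⟩
  have hmin' : ∀ w', IsSpread t w' → monomial w' (1 : K) ∈ I → w' ≤ v →
      indexWeight w ≤ indexWeight w' := fun w' h1 h2 h3 => not_lt.mp (hmin w' ⟨h1, h2, h3⟩)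
  have hwG : w ∈ minGens I := by
    obtain ⟨g, hg, hgw⟩ := exists_minGens_le hwI
    rcases hgw.eq_or_lt with rfl | hlt
    · exact hg
    · exact absurd (indexWeight_lt_of_lt hlt)
        (not_lt.mpr (hmin' g (hI.1.2 g hg) hg.1 (hgw.trans hwv)))
  have hw0 := minGens_ne_zero htop hwG
  refine ⟨w, hwG, hwv, ?_⟩
  by_contra hcon
  push Not at hcon
  have hne : (Finset.univ.filter fun i => w i < v i ∧ ∃ j ∈ w.support, i < j).Nonempty := by
    obtain ⟨i, h1, j, hj, h2⟩ := hcon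
    exact ⟨i, by simp only [Finset.mem_filter_univ]; exact ⟨h1, j, hj, h2⟩⟩
  obtain ⟨i, hi, himin⟩ := Finset.exists_min_image _ id hne
  rw [Finset.mem_filter_univ] at hi
  obtain ⟨hi, j, hj, hij⟩ := hi
  have heq : ∀ l < i, w l = v l := by
    intro l hl
    refine le_antisymm (hwv l) (not_lt.mp fun h => ?_)
    have := himin l (by simp only [Finset.mem_filter_univ]; exact ⟨h, j, hj, hl.trans hij⟩)
    exact absurd this (not_le.mpr hl)
  have hfree : i ∈ freeVars t w := mem_freeVars.mpr
    ⟨hij.trans_le (le_maxVar hj), notMem_spreadSupport_of_lt hw hv heq hi⟩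
  obtain ⟨h1, h2⟩ := monomial_swap_mem hI hw0 hw hwI hfree
  have h3 := congrArg indexWeight (swap_add hj hij)
  simp only [indexWeight_add, indexWeight_single] at h3
  have h4 := (nextVar_spec hj hij).2
  have h5 : swap w i ≤ v := by
    intro l
    have h6 := DFunLike.congr_fun (swap_add hj hij) l
    simp only [Finsupp.add_apply] at h6
    by_cases hl : i = l
    · subst hl
      simp only [Finsupp.single_eq_same] at h6
      omega
    · rw [Finsupp.single_eq_of_ne (Ne.symm hl)] at h6
      have := hwv l
      omega
  have h6 := hmin' _ h1 h2 h5
  rw [Fin.lt_def] at h4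
  omega

/-- If a `t`-spread monomial `v ∈ I` arises from `u ∈ G(I)` by raising the exponent of `x_k` by one,
`k < max(u)`, without changing the exponents below `k`, then `v` is divisible by a minimal generator
that is lexicographically larger than `u`. -/
theorem exists_minGens_lex_lt (hI : IsSpreadStronglyStable t I) (htop : I ≠ ⊤)
    {u v : Fin n →₀ ℕ} (hu : u ∈ minGens I) (hv : IsSpread t v) (hvI : monomial v (1 : K) ∈ I)
    {k j : Fin n} (hj : j ∈ u.support) (hkj : k < j) (heq : ∀ i < k, v i = u i)
    (hk : v k = u k + 1) : ∃ w ∈ minGens I, w ≤ v ∧ toLex u < toLex w := by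
  obtain ⟨w, hw, hwv, hinit⟩ := exists_initial_minGens hI htop hv hvI
  refine ⟨w, hw, hwv, ?_⟩
  by_cases h : ∃ i ≤ k, w i < v i
  · exfalso
    obtain ⟨i, hik, hi⟩ := h
    have hwu : w ≤ u := by
      intro l
      rcases lt_trichotomy l k with hl | rfl | hl
      · exact heq l hl ▸ hwv l
      · rcases hik.eq_or_lt with rfl | hil
        · omega
        · by_contra h
          have := hinit i hi l (Finsupp.mem_support_iff.mpr (by omega))
          exact absurd this (not_le.mpr hil)
      · by_contra h
        have := hinit i hi l (Finsupp.mem_support_iff.mpr (by omega))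
        exact absurd this (not_le.mpr (hik.trans_lt hl))
    have huw : u ≤ w := hu.2 hw.1 hwu
    have hjw : j ∈ w.support := by
      rw [Finsupp.mem_support_iff] at hj ⊢
      have := huw j
      omega
    exact absurd (hinit i hi j hjw) (not_le.mpr (hik.trans_lt hkj))
  · push Not at h
    refine Finsupp.Lex.lt_iff.mpr ⟨k, fun i hi => ?_, ?_⟩
    · exact (le_antisymm (hwv i) (h i hi.le)).trans (heq i hi) |>.symm
    · have := h k le_rfl
      change u k < w k
      omega

/-- The monomial `x_F (u / x_{F^{(u)}})`. -/
def exchange (u : Fin n →₀ ℕ) (F : Finset (Fin n)) : Fin n →₀ ℕ :=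
  ∑ k ∈ F, Finsupp.single k 1 + (u - ∑ k ∈ F, Finsupp.single (nextVar u k) 1)

theorem sum_single_nextVar_le {u : Fin n →₀ ℕ} {F : Finset (Fin n)} (hu : u ≠ 0)
    (hF : ∀ k ∈ F, k < maxVar u) (hinj : Set.InjOn (nextVar u) F) :
    ∑ k ∈ F, Finsupp.single (nextVar u k) 1 ≤ u := by
  intro i
  rw [Finsupp.finsetSum_apply]
  by_cases h : ∃ k ∈ F, nextVar u k = i
  · obtain ⟨k, hk, rfl⟩ := h
    rw [Finset.sum_eq_single_of_mem k hk fun l hl hlk => ?_]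
    · rw [Finsupp.single_eq_same]
      exact Nat.one_le_iff_ne_zero.mpr
        (Finsupp.mem_support_iff.mp (nextVar_spec (maxVar_mem hu) (hF k hk)).1)
    · exact Finsupp.single_eq_of_ne fun h => hlk (hinj hl hk h.symm)
  · push Not at h
    rw [Finset.sum_eq_zero fun k hk => Finsupp.single_eq_of_ne (h k hk).symm]
    exact Nat.zero_le _

theorem exchange_add {u : Fin n →₀ ℕ} {F : Finset (Fin n)} (hu : u ≠ 0)
    (hF : ∀ k ∈ F, k < maxVar u) (hinj : Set.InjOn (nextVar u) F) :
    exchange u F + ∑ k ∈ F, Finsupp.single (nextVar u k) 1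
      = u + ∑ k ∈ F, Finsupp.single k 1 := by
  rw [exchange, add_assoc, tsub_add_cancel_of_le (sum_single_nextVar_le hu hF hinj), add_comm]

/-- `x_F (u / x_{F^{(u)}})` is obtained from `u` by exchanges at the elements of `F` in decreasing
order, so it is a `t`-spread monomial of `I`. -/
theorem isSpread_exchange (hI : IsSpreadStronglyStable t I) {u : Fin n →₀ ℕ} (hu0 : u ≠ 0)
    (hu : IsSpread t u) (huI : monomial u (1 : K) ∈ I) {F : Finset (Fin n)}
    (hF : F ⊆ freeVars t u) (hinj : Set.InjOn (nextVar u) F) :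
    IsSpread t (exchange u F) ∧ monomial (exchange u F) (1 : K) ∈ I := by
  induction F using Finset.induction_on_max generalizing u with
  | empty => simpa [exchange] using ⟨hu, huI⟩
  | insert k F hk ih =>
    have hkF : k ∉ F := fun h => lt_irrefl _ (hk k h)
    have hkf := hF (Finset.mem_insert_self _ _)
    have hkm := (mem_freeVars.mp hkf).1
    have hmax := maxVar_mem hu0
    obtain ⟨h1, h2⟩ := monomial_swap_mem hI hu0 hu huI hkf
    have hks : k ∈ (swap u k).support := by
      rw [Finsupp.mem_support_iff]; simp [swap]
    have hv0 : swap u k ≠ 0 := by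
      intro h; rw [h] at hks; simp at hks
    have hnext : ∀ f ∈ F, nextVar (swap u k) f = nextVar u f := by
      intro f hf
      refine nextVar_swap hmax hkm (hk f hf) fun h => (hk f hf).ne ?_
      exact hinj (Finset.mem_insert_of_mem hf) (Finset.mem_insert_self _ _) h
    have hF' : F ⊆ freeVars t (swap u k) := by
      intro f hf
      have := hF (Finset.mem_insert_of_mem hf)
      rw [mem_freeVars] at this ⊢
      exact ⟨(hk f hf).trans_le (le_maxVar hks),
        notMem_spreadSupport_swap hmax hkm (hk f hf) this.2⟩
    have hinj' : Set.InjOn (nextVar u) F :=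
      hinj.mono (Finset.coe_subset.mpr (Finset.subset_insert _ _))
    have hinj'' : Set.InjOn (nextVar (swap u k)) F := by
      intro a ha b hb hab
      rw [hnext a ha, hnext b hb] at hab
      exact hinj' ha hb hab
    have hexch : exchange u (insert k F) = exchange (swap u k) F := by
      have e1 := exchange_add hu0 (fun f hf => (mem_freeVars.mp (hF hf)).1) hinj
      have e2 := exchange_add hv0 (fun f hf => (mem_freeVars.mp (hF' hf)).1) hinj''
      have e3 := swap_add hmax hkm
      rw [Finset.sum_congr rfl fun f hf => by rw [hnext f hf]] at e2
      rw [Finset.sum_insert hkF, Finset.sum_insert hkF] at e1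
      ext i
      have e1 := DFunLike.congr_fun e1 i
      have e2 := DFunLike.congr_fun e2 i
      have e3 := DFunLike.congr_fun e3 i
      simp only [Finsupp.add_apply] at e1 e2 e3
      omega
    rw [hexch]
    exact ih hv0 h1 h2 hF' hinj''

theorem exists_minGens_lex_lt_exchange (hI : IsSpreadStronglyStable t I) (htop : I ≠ ⊤)
    {u : Fin n →₀ ℕ} (hu : u ∈ minGens I) {F : Finset (Fin n)} (hne : F.Nonempty)
    (hF : F ⊆ freeVars t u) (hinj : Set.InjOn (nextVar u) F) :
    ∃ w ∈ minGens I, w ≤ exchange u F ∧ toLex u < toLex w := by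
  have hu0 := minGens_ne_zero htop hu
  have hFm : ∀ k ∈ F, k < maxVar u := fun k hk => (mem_freeVars.mp (hF hk)).1
  obtain ⟨h1, h2⟩ := isSpread_exchange hI hu0 (hI.1.2 u hu) hu.1 hF hinj
  obtain ⟨k, hk, hkmin⟩ := Finset.exists_min_image F id hne
  have hval : ∀ i ≤ k, exchange u F i = u i + if i = k then 1 else 0 := by
    intro i hi
    have e := DFunLike.congr_fun (exchange_add hu0 hFm hinj) i
    simp only [Finsupp.add_apply, Finsupp.finsetSum_apply] at e
    rw [Finset.sum_eq_zero fun l hl => ?_, add_zero] at e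
    · rw [e]
      congr 1
      split_ifs with h
      · subst h
        rw [Finset.sum_eq_single_of_mem i hk fun l _ hl => Finsupp.single_eq_of_ne (Ne.symm hl),
          Finsupp.single_eq_same]
      · refine Finset.sum_eq_zero fun l hl => Finsupp.single_eq_of_ne ?_
        rintro rfl
        exact h (le_antisymm hi (hkmin _ hl))
    · refine Finsupp.single_eq_of_ne (ne_of_lt ?_)
      exact (hi.trans (hkmin l hl)).trans_lt (nextVar_spec (maxVar_mem hu0) (hFm l hl)).2
  refine exists_minGens_lex_lt hI htop hu h1 h2 (maxVar_mem hu0) (hFm k hk)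
    (fun i hi => ?_) ?_
  · rw [hval i hi.le, if_neg hi.ne, add_zero]
  · rw [hval k le_rfl, if_pos rfl]

theorem indexWeight_exchange_lt {u : Fin n →₀ ℕ} {F : Finset (Fin n)} (hu : u ≠ 0)
    (hne : F.Nonempty) (hF : ∀ k ∈ F, k < maxVar u) (hinj : Set.InjOn (nextVar u) F) :
    indexWeight (exchange u F) < indexWeight u := by
  have hsum : ∀ g : Fin n → Fin n, indexWeight (∑ k ∈ F, Finsupp.single (g k) 1)
      = ∑ k ∈ F, ((g k : ℕ) + 1) := by
    intro g
    rw [indexWeight, map_sum]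
    exact Finset.sum_congr rfl fun k _ => indexWeight_single _
  have h := congrArg indexWeight (exchange_add hu hF hinj)
  have hlt : ∑ k ∈ F, ((k : ℕ) + 1) < ∑ k ∈ F, ((nextVar u k : ℕ) + 1) :=
    Finset.sum_lt_sum_of_nonempty hne fun k hk =>
      Nat.succ_lt_succ (nextVar_spec (maxVar_mem hu) (hF k hk)).2
  rw [indexWeight_add, indexWeight_add, hsum, hsum fun k => k] at h
  omega

/-- If no free variable of the minimal generator `x^u` divides `x^w`, then `x^u` is the
lexicographically largest minimal generator dividing `x^u x^w`. -/
theorem toLex_le_of_free (hI : IsSpreadStronglyStable t I) {u v w : Fin n →₀ ℕ}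
    (hu : u ∈ minGens I) (hv : v ∈ minGens I) (hw : ∀ j ∈ w.support, j ∉ freeVars t u)
    (hle : v ≤ u + w) : toLex v ≤ toLex u := by
  by_contra hlt
  obtain ⟨k, heq, hk⟩ := Finsupp.Lex.lt_iff.mp (not_le.mp hlt)
  change ∀ i < k, u i = v i at heq
  change u k < v k at hk
  have hkw : k ∈ w.support := by
    have := hle k
    rw [Finsupp.add_apply] at this
    rw [Finsupp.mem_support_iff]
    omega
  have hkf := hw k hkw
  rw [mem_freeVars, not_and, not_not] at hkf
  by_cases hkm : k < maxVar u
  · exact notMem_spreadSupport_of_lt (hI.1.2 u hu) (hI.1.2 v hv) heq hk (hkf hkm)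
  · have huv : u ≤ v := by
      intro i
      rcases lt_trichotomy i k with hi | rfl | hi
      · exact (heq i hi).le
      · exact hk.le
      · by_contra h
        have := le_maxVar (u := u) (j := i) (Finsupp.mem_support_iff.mpr (by omega))
        exact hkm (hi.trans_le this)
    have := hv.2 hu.1 huv k
    omega

/-- If `u` is the lexicographically largest minimal generator dividing the monomial `x^b`, then no
free variable of `u` divides `x^b / x^u`. -/
theorem notMem_freeVars_of_max (hI : IsSpreadStronglyStable t I) (htop : I ≠ ⊤)
    {u b : Fin n →₀ ℕ} (hu : u ∈ minGens I) (hub : u ≤ b)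
    (hmax : ∀ v ∈ minGens I, v ≤ b → toLex v ≤ toLex u) {k : Fin n}
    (hk : k ∈ (b - u).support) : k ∉ freeVars t u := by
  intro hkf
  have hu0 := minGens_ne_zero htop hu
  have hkm := (mem_freeVars.mp hkf).1
  obtain ⟨h1, h2⟩ := monomial_swap_mem hI hu0 (hI.1.2 u hu) hu.1 hkf
  have hn := (nextVar_spec (maxVar_mem hu0) hkm).2
  have hadd := DFunLike.congr_fun (swap_add (maxVar_mem hu0) hkm)
  simp only [Finsupp.add_apply] at hadd
  obtain ⟨w, hw, hwv, hlt⟩ := exists_minGens_lex_lt hI htop hu h1 h2 (maxVar_mem hu0) hkm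
    (fun i hi => by
      have := hadd i
      rwa [Finsupp.single_eq_of_ne (hi.trans hn).ne, Finsupp.single_eq_of_ne hi.ne] at this)
    (by
      have := hadd k
      rwa [Finsupp.single_eq_of_ne hn.ne, Finsupp.single_eq_same] at this)
  refine absurd (hmax w hw (hwv.trans fun i => ?_)) (not_le.mpr hlt)
  have h := hadd i
  have hb := hub i
  rw [Finsupp.mem_support_iff, Finsupp.tsub_apply] at hk
  by_cases hik : i = k
  · subst hik
    rw [Finsupp.single_eq_same] at h
    omega
  · rw [Finsupp.single_eq_of_ne hik] at h
    omega

end StronglyStable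

/-! ### Cycles of a Koszul complex with a Stanley decomposition -/

section Cells

variable (K : Type*) [Field K] (n : ℕ)

/-- The `K`-basis `x^b e_A` of the Koszul complex of the polynomial ring. -/
def cellBasis : Module.Basis ((Fin n →₀ ℕ) × Finset (Fin n)) K
    (ExteriorAlgebra (MvPolynomial (Fin n) K) (Fin n → MvPolynomial (Fin n) K)) :=
  (basisMonomials (Fin n) K).smulTower (wedgeBasis (MvPolynomial (Fin n) K) n)

variable {n}

theorem cellBasis_apply (b : Fin n →₀ ℕ) (A : Finset (Fin n)) :
    cellBasis K n (b, A)
      = monomial b (1 : K) • wedgeBasis (MvPolynomial (Fin n) K) n A := by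
  rw [cellBasis, Module.Basis.smulTower_apply, coe_basisMonomials]

theorem cellBasis_repr
    (x : ExteriorAlgebra (MvPolynomial (Fin n) K) (Fin n → MvPolynomial (Fin n) K))
    (b : Fin n →₀ ℕ) (A : Finset (Fin n)) :
    (cellBasis K n).repr x (b, A)
      = coeff b ((wedgeBasis (MvPolynomial (Fin n) K) n).repr x A) := by
  rw [cellBasis, Module.Basis.smulTower_repr]
  rfl

/-- The Koszul differential of the polynomial ring, as a `K`-linear map. -/
def polyD : ExteriorAlgebra (MvPolynomial (Fin n) K) (Fin n → MvPolynomial (Fin n) K) →ₗ[K]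
    ExteriorAlgebra (MvPolynomial (Fin n) K) (Fin n → MvPolynomial (Fin n) K) :=
  (koszulD (X : Fin n → MvPolynomial (Fin n) K)).restrictScalars K

theorem polyD_cellBasis (b : Fin n →₀ ℕ) (A : Finset (Fin n)) :
    ∃ s : Fin n → ℕ, polyD K (cellBasis K n (b, A))
      = ∑ j ∈ A, (-1 : K) ^ s j • cellBasis K n (b + Finsupp.single j 1, A.erase j) := by
  obtain ⟨s, hs⟩ := koszulD_wedgeBasis (MvPolynomial (Fin n) K) X A
  refine ⟨s, ?_⟩
  change koszulD X _ = _
  rw [cellBasis_apply, map_smul, hs, Finset.smul_sum]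
  refine Finset.sum_congr rfl fun j _ => ?_
  rw [cellBasis_apply, ← algebraMap_smul (MvPolynomial (Fin n) K) ((-1 : K) ^ s j), smul_smul,
    smul_smul, smul_smul]
  congr 1
  rw [map_pow, map_neg, RingHom.map_one, X, mul_right_comm, monomial_mul, one_mul, mul_comm]

variable {K} in
theorem polyD_polyD
    (x : ExteriorAlgebra (MvPolynomial (Fin n) K) (Fin n → MvPolynomial (Fin n) K)) :
    polyD K (polyD K x) = 0 := koszulD_koszulD _ _

/-- The span of the `x^b e_A` with `b ∈ D` and `|A| = i`. If `D` is the set of the monomials of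
a monomial ideal `I`, this is the degree `i` part of the Koszul complex of `I`. -/
def cellSpan (D : Set (Fin n →₀ ℕ)) (i : ℕ) : Submodule K
    (ExteriorAlgebra (MvPolynomial (Fin n) K) (Fin n → MvPolynomial (Fin n) K)) :=
  Submodule.span K (cellBasis K n '' {p | p.1 ∈ D ∧ p.2.card = i})

variable {K}

theorem mem_cellSpan {D : Set (Fin n →₀ ℕ)} {i : ℕ}
    {x : ExteriorAlgebra (MvPolynomial (Fin n) K) (Fin n → MvPolynomial (Fin n) K)} :
    x ∈ cellSpan K D i ↔ ∀ b A, (cellBasis K n).repr x (b, A) ≠ 0 → b ∈ D ∧ A.card = i := by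
  rw [cellSpan, Module.Basis.mem_span_image]
  simp only [Set.subset_def, Finset.mem_coe, Finsupp.mem_support_iff, Set.mem_ofPred_eq,
    Prod.forall]

theorem cellBasis_mem_cellSpan {D : Set (Fin n →₀ ℕ)} {b : Fin n →₀ ℕ} (hb : b ∈ D)
    {A : Finset (Fin n)} {i : ℕ} (hA : A.card = i) : cellBasis K n (b, A) ∈ cellSpan K D i :=
  Submodule.subset_span ⟨(b, A), ⟨hb, hA⟩, rfl⟩

end Cells

/-- A set `D` of monomials, closed under multiplication by the variables, together with
a decomposition into the disjoint pieces `u K[x_j : j ∉ free u]`, `u ∈ gens`. The piece containing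
`b ∈ D` is the one of `gen b`, and multiplying `b` by a variable that is free for `gen b` leads to
a piece of smaller rank. -/
structure StanleyDecomposition (n : ℕ) where
  /-- the set of monomials that is decomposed -/
  D : Set (Fin n →₀ ℕ)
  /-- the set of generators of the pieces -/
  gens : Set (Fin n →₀ ℕ)
  /-- the variables that lead out of a piece -/
  free : (Fin n →₀ ℕ) → Finset (Fin n)
  /-- the generator of the piece of a monomial -/
  gen : (Fin n →₀ ℕ) → (Fin n →₀ ℕ)
  /-- the rank of the piece of a generator -/
  rank : (Fin n →₀ ℕ) → ℕ
  add_single_mem : ∀ b ∈ D, ∀ k, b + Finsupp.single k 1 ∈ D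
  gen_mem : ∀ b ∈ D, gen b ∈ gens
  gen_le : ∀ b ∈ D, gen b ≤ b
  notMem_free : ∀ b ∈ D, ∀ j ∈ (b - gen b).support, j ∉ free (gen b)
  add_mem : ∀ u ∈ gens, ∀ w : Fin n →₀ ℕ, (∀ j ∈ w.support, j ∉ free u) → u + w ∈ D
  gen_add : ∀ u ∈ gens, ∀ w : Fin n →₀ ℕ, (∀ j ∈ w.support, j ∉ free u) → gen (u + w) = u
  rank_lt : ∀ b ∈ D, ∀ k ∈ free (gen b), rank (gen (b + Finsupp.single k 1)) < rank (gen b)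

namespace StanleyDecomposition

variable {n : ℕ} (P : StanleyDecomposition n)

theorem gen_add_single {b : Fin n →₀ ℕ} (hb : b ∈ P.D) {k : Fin n} (hk : k ∉ P.free (P.gen b)) :
    P.gen (b + Finsupp.single k 1) = P.gen b := by
  have h : b + Finsupp.single k 1 = P.gen b + ((b - P.gen b) + Finsupp.single k 1) := by
    rw [← add_assoc, add_tsub_cancel_of_le (P.gen_le b hb)]
  rw [h]
  refine P.gen_add _ (P.gen_mem b hb) _ fun j hj => ?_
  rcases Finset.mem_union.mp (Finsupp.support_add hj) with hj | hj
  · exact P.notMem_free b hb j hj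
  · rw [Finset.mem_singleton.mp (Finsupp.support_single_subset hj)]
    exact hk

/-- The non-free variables occurring in the cell `x^b e_A`, either in the cofactor of `gen b` in
`x^b` or in `e_A`. -/
def active (b : Fin n →₀ ℕ) (A : Finset (Fin n)) : Finset (Fin n) :=
  ((b - P.gen b).support ∪ A) \ P.free (P.gen b)

theorem mem_active {b : Fin n →₀ ℕ} {A : Finset (Fin n)} {i : Fin n} :
    i ∈ P.active b A ↔ ((b - P.gen b) i ≠ 0 ∨ i ∈ A) ∧ i ∉ P.free (P.gen b) := by
  rw [active, Finset.mem_sdiff, Finset.mem_union, Finsupp.mem_support_iff]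

/-- Replacing `e_j` by `x_j` does not change the set of active variables, unless it leads to
another piece. -/
theorem active_add_single {b : Fin n →₀ ℕ} {A : Finset (Fin n)} (hb : b ∈ P.D) {j : Fin n}
    (hj : j ∈ A) (hjf : j ∉ P.free (P.gen b)) :
    P.active (b + Finsupp.single j 1) (A.erase j) = P.active b A := by
  ext i
  rw [mem_active, mem_active, P.gen_add_single hb hjf]
  have hle := P.gen_le b hb i
  simp only [Finsupp.tsub_apply, Finsupp.add_apply, Finset.mem_erase]
  by_cases hij : i = j
  · subst hij
    rw [Finsupp.single_eq_same]
    simp only [hj, or_true]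
    have : b i + 1 - P.gen b i ≠ 0 := by omega
    simp [this]
  · rw [Finsupp.single_eq_of_ne hij]
    simp [hij]

/-- The cells `x^b e_A` such that the first active variable occurs in `e_A`. Such a cell is matched
with the cell in which `e_j` is replaced by `x_j`, for the first active `j`. -/
def IsUpper (b : Fin n →₀ ℕ) (A : Finset (Fin n)) : Prop :=
  ∃ j ∈ A, j ∈ P.active b A ∧ ∀ i ∈ P.active b A, j ≤ i

variable (K : Type*) [Field K]

/-- The span of the upper cells of homological degree `i`. -/
def upperSpan (i : ℕ) : Submodule K
    (ExteriorAlgebra (MvPolynomial (Fin n) K) (Fin n → MvPolynomial (Fin n) K)) :=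
  Submodule.span K (cellBasis K n '' {p | (p.1 ∈ P.D ∧ p.2.card = i) ∧ P.IsUpper p.1 p.2})

variable {K}

/-- The matching partner of an upper cell `(b, A)` does not occur in the boundary of any other upper
cell `(b', A')` of at most the same rank. -/
theorem eq_of_isUpper {b b' : Fin n →₀ ℕ} {A A' : Finset (Fin n)} (hb : b ∈ P.D)
    (hb' : b' ∈ P.D) (hp' : P.IsUpper b' A') {j k : Fin n} (hj : j ∈ A)
    (hja : j ∈ P.active b A) (hmin : ∀ i ∈ P.active b A, j ≤ i)
    (hrank : P.rank (P.gen b') ≤ P.rank (P.gen b)) (hk : k ∈ A')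
    (hbk : b' + Finsupp.single k 1 = b + Finsupp.single j 1) (hAk : A'.erase k = A.erase j) :
    b' = b ∧ A' = A := by
  have hjf := (P.mem_active.mp hja).2
  have hkf : k ∉ P.free (P.gen b') := by
    intro hkf
    have := P.rank_lt b' hb' k hkf
    rw [hbk, P.gen_add_single hb hjf] at this
    omega
  have hact : P.active b' A' = P.active b A := by
    rw [← P.active_add_single hb' hk hkf, hbk, hAk, P.active_add_single hb hj hjf]
  obtain ⟨j', hj', hja', hmin'⟩ := hp'
  have hjj : j' = j := le_antisymm (hmin' j (hact ▸ hja)) (hmin j' (hact ▸ hja'))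
  subst hjj
  have hkj : k = j' := by
    by_contra hkj
    have : j' ∈ A'.erase k := Finset.mem_erase.mpr ⟨Ne.symm hkj, hj'⟩
    rw [hAk] at this
    exact Finset.notMem_erase _ _ this
  subst hkj
  refine ⟨add_right_cancel hbk, ?_⟩
  rw [← Finset.insert_erase hk, hAk, Finset.insert_erase hj]

/-- The Koszul differential is injective on the span of the upper cells. -/
theorem eq_zero_of_mem_upperSpan {i : ℕ}
    {x : ExteriorAlgebra (MvPolynomial (Fin n) K) (Fin n → MvPolynomial (Fin n) K)}
    (hx : x ∈ P.upperSpan K i) (hdx : polyD K x = 0) : x = 0 := by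
  by_contra hx0
  rw [upperSpan, Module.Basis.mem_span_image] at hx
  have hne : ((cellBasis K n).repr x).support.Nonempty := by
    rw [Finsupp.support_nonempty_iff]
    simpa using hx0
  -- For a cell `(b, A)` of maximal rank in `x`, the matched cell occurs in the boundary of no
  -- other cell of `x`.
  obtain ⟨⟨b, A⟩, hp, hmax⟩ :=
    Finset.exists_max_image _ (fun p => P.rank (P.gen p.1)) hne
  obtain ⟨⟨hb, -⟩, j, hj, hja, hmin⟩ := hx hp
  have hcoef : (cellBasis K n).repr (polyD K x) (b + Finsupp.single j 1, A.erase j) ≠ 0 := by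
    conv_lhs => rw [← (cellBasis K n).linearCombination_repr x]
    rw [Finsupp.linearCombination_apply, Finsupp.sum, map_sum, map_sum, Finsupp.finsetSum_apply,
      Finset.sum_eq_single_of_mem (b, A) hp]
    · obtain ⟨s, hs⟩ := polyD_cellBasis K b A
      rw [map_smul, hs, map_smul, Finsupp.smul_apply, map_sum, Finsupp.finsetSum_apply,
        Finset.sum_eq_single_of_mem j hj]
      · rw [map_smul, Module.Basis.repr_self, Finsupp.smul_apply, Finsupp.single_eq_same]
        refine smul_ne_zero (Finsupp.mem_support_iff.mp hp) ?_
        exact smul_ne_zero (pow_ne_zero _ (neg_ne_zero.mpr one_ne_zero)) one_ne_zero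
      · intro k hk hkj
        rw [map_smul, Module.Basis.repr_self, Finsupp.smul_apply, Finsupp.single_eq_of_ne,
          smul_zero]
        intro h
        have h2 : A.erase j = A.erase k := congrArg Prod.snd h
        have : j ∈ A.erase k := Finset.mem_erase.mpr ⟨Ne.symm hkj, hj⟩
        rw [← h2] at this
        exact Finset.notMem_erase _ _ this
    · rintro ⟨b', A'⟩ hp' hne'
      obtain ⟨⟨hb', -⟩, hup'⟩ := hx hp'
      obtain ⟨s, hs⟩ := polyD_cellBasis K b' A'
      rw [map_smul, hs, map_smul, Finsupp.smul_apply, map_sum, Finsupp.finsetSum_apply,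
        Finset.sum_eq_zero, smul_zero]
      intro k hk
      rw [map_smul, Module.Basis.repr_self, Finsupp.smul_apply, Finsupp.single_eq_of_ne,
        smul_zero]
      intro h
      have h1 := congrArg Prod.fst h
      have h2 := congrArg Prod.snd h
      obtain ⟨rfl, rfl⟩ := P.eq_of_isUpper hb hb' hup' hj hja hmin (hmax _ hp') hk h1.symm h2.symm
      exact hne' rfl
  rw [hdx] at hcoef
  simp at hcoef

/-- Modulo boundaries and the span of elements `ζ u σ` with leading cells `x^u e_σ`, every cell is in
the span of the upper cells. A cell whose first active variable does not occur in `e_A` is, up to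
sign, the leading term of the boundary of an upper cell; a cell without active variables is the
leading term of some `ζ u σ`. The remaining terms have smaller rank or are upper cells. -/
theorem cellBasis_mem_sup
    (ζ : (Fin n →₀ ℕ) → Finset (Fin n) →
      ExteriorAlgebra (MvPolynomial (Fin n) K) (Fin n → MvPolynomial (Fin n) K))
    (hζ : ∀ u ∈ P.gens, ∀ σ ⊆ P.free u, ∃ s : ℕ, ζ u σ - (-1 : K) ^ s • cellBasis K n (u, σ) ∈
      cellSpan K {b | b ∈ P.D ∧ P.rank (P.gen b) < P.rank u} σ.card)
    (b : Fin n →₀ ℕ) (hb : b ∈ P.D) (A : Finset (Fin n)) (i : ℕ) (hA : A.card = i) :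
    cellBasis K n (b, A) ∈ P.upperSpan K i ⊔ (cellSpan K P.D (i + 1)).map (polyD K) ⊔
      Submodule.span K {z | ∃ u ∈ P.gens, ∃ σ ⊆ P.free u, σ.card = i ∧ ζ u σ = z} := by
  set M := P.upperSpan K i ⊔ (cellSpan K P.D (i + 1)).map (polyD K) ⊔
      Submodule.span K {z | ∃ u ∈ P.gens, ∃ σ ⊆ P.free u, σ.card = i ∧ ζ u σ = z} with hM
  have hupper : ∀ b' ∈ P.D, ∀ A' : Finset (Fin n), A'.card = i → P.IsUpper b' A' →
      cellBasis K n (b', A') ∈ M := fun b' hb' A' hA' h =>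
    le_sup_left (a := P.upperSpan K i ⊔ _) (le_sup_left (a := P.upperSpan K i)
      (Submodule.subset_span ⟨(b', A'), ⟨⟨hb', hA'⟩, h⟩, rfl⟩))
  have hneg : ∀ s : ℕ, ∀ x y : ExteriorAlgebra (MvPolynomial (Fin n) K)
      (Fin n → MvPolynomial (Fin n) K), (-1 : K) ^ s • x + y ∈ M → y ∈ M → x ∈ M := by
    intro s x y hxy hy
    have h1 := M.sub_mem hxy hy
    rw [add_sub_cancel_right] at h1
    exact (M.smul_mem_iff (pow_ne_zero s (neg_ne_zero.mpr one_ne_zero))).mp h1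
  induction hr : P.rank (P.gen b) using Nat.strong_induction_on generalizing b A with
  | _ r ih =>
  by_cases hT : (P.active b A).Nonempty
  · obtain ⟨j, hj, hmin⟩ := Finset.exists_min_image _ id hT
    by_cases hjA : j ∈ A
    · exact hupper b hb A hA ⟨j, hjA, hj, hmin⟩
    · obtain ⟨hj1, hjf⟩ := P.mem_active.mp hj
      have hjb := hj1.resolve_right hjA
      -- The cell is matched with the upper cell `(b', insert j A)`, where `b' = b / x_j`.
      have hsub : Finsupp.single j 1 ≤ b - P.gen b :=
        single_le_of_mem_support (Finsupp.mem_support_iff.mpr hjb)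
      obtain ⟨w, hw⟩ := exists_add_of_le hsub
      have hwf : ∀ l ∈ w.support, l ∉ P.free (P.gen b) := by
        intro l hl
        refine P.notMem_free b hb l ?_
        rw [Finsupp.mem_support_iff] at hl ⊢
        rw [hw, Finsupp.add_apply]
        omega
      have hb'D := P.add_mem _ (P.gen_mem b hb) w hwf
      have hb'g := P.gen_add _ (P.gen_mem b hb) w hwf
      set b' := P.gen b + w with hb'
      have hbb' : b' + Finsupp.single j 1 = b := by
        rw [hb', add_assoc, add_comm w, ← hw, add_tsub_cancel_of_le (P.gen_le b hb)]
      have hcard : (insert j A).card = i + 1 := by rw [Finset.card_insert_of_notMem hjA, hA]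
      have hbd : polyD K (cellBasis K n (b', insert j A)) ∈ M :=
        le_sup_left (a := P.upperSpan K i ⊔ _) (le_sup_right (a := P.upperSpan K i)
          (Submodule.mem_map_of_mem (cellBasis_mem_cellSpan hb'D hcard)))
      obtain ⟨s, hs⟩ := polyD_cellBasis K b' (insert j A)
      rw [hs, Finset.sum_insert hjA, Finset.erase_insert hjA, hbb'] at hbd
      refine hneg _ _ _ hbd (M.sum_mem fun k hk => M.smul_mem _ ?_)
      have hkj : k ≠ j := by rintro rfl; exact hjA hk
      have hk' : k ∈ insert j A := Finset.mem_insert_of_mem hk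
      have hcard' : ((insert j A).erase k).card = i := by
        rw [Finset.card_erase_of_mem hk', hcard, Nat.add_sub_cancel]
      have hbD := P.add_single_mem b' hb'D k
      by_cases hkf : k ∈ P.free (P.gen b)
      · refine ih _ ?_ _ hbD _ hcard' rfl
        have := P.rank_lt b' hb'D k (hb'g ▸ hkf)
        rwa [hb'g, hr] at this
      · refine hupper _ hbD _ hcard' ⟨j, ?_, ?_⟩
        · exact Finset.mem_erase.mpr ⟨hkj.symm, Finset.mem_insert_self _ _⟩
        · have hact : P.active (b' + Finsupp.single k 1) ((insert j A).erase k)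
              = P.active b A := by
            rw [P.active_add_single hb'D hk' (hb'g ▸ hkf),
              ← P.active_add_single hb'D (Finset.mem_insert_self j A) (hb'g ▸ hjf), hbb',
              Finset.erase_insert hjA]
          rw [hact]
          exact ⟨hj, hmin⟩
  · -- No variable is active: the cell is the leading cell of some `ζ u σ`.
    rw [Finset.not_nonempty_iff_eq_empty] at hT
    have hno : ∀ l, ((b - P.gen b) l ≠ 0 ∨ l ∈ A) → l ∈ P.free (P.gen b) := by
      intro l hl
      by_contra hlf
      have := P.mem_active.mpr ⟨hl, hlf⟩
      rw [hT] at this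
      simp at this
    have hgb : P.gen b = b := by
      refine le_antisymm (P.gen_le b hb) fun l => ?_
      by_contra hlt
      have h0 : (b - P.gen b) l ≠ 0 := by
        rw [Finsupp.tsub_apply]; omega
      exact P.notMem_free b hb l (Finsupp.mem_support_iff.mpr h0) (hno l (Or.inl h0))
    have hbG : b ∈ P.gens := hgb ▸ P.gen_mem b hb
    have hAf : A ⊆ P.free b := fun l hl => hgb ▸ hno l (Or.inr hl)
    obtain ⟨s, hs⟩ := hζ b hbG A hAf
    have hy : ζ b A - (-1 : K) ^ s • cellBasis K n (b, A) ∈ M := by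
      refine (Submodule.span_le.mpr ?_ : cellSpan K _ _ ≤ M) hs
      rintro _ ⟨⟨b', A'⟩, ⟨⟨h1, h2⟩, h3⟩, rfl⟩
      refine ih _ ?_ b' h1 A' (h3.trans hA) rfl
      rwa [← hr, hgb]
    have hz : ζ b A ∈ M := le_sup_right (a := P.upperSpan K i ⊔ _)
      (Submodule.subset_span ⟨b, hbG, A, hAf, hA, rfl⟩)
    refine hneg s _ _ ?_ hy
    rwa [add_sub_cancel]

/-- The cycles of the Koszul complex of an ideal with a Stanley decomposition are spanned by the
boundaries and any cycles `ζ u σ` with leading cells `x^u e_σ`. -/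
theorem mem_sup_of_cycle
    (ζ : (Fin n →₀ ℕ) → Finset (Fin n) →
      ExteriorAlgebra (MvPolynomial (Fin n) K) (Fin n → MvPolynomial (Fin n) K))
    (hζ : ∀ u ∈ P.gens, ∀ σ ⊆ P.free u, ∃ s : ℕ, ζ u σ - (-1 : K) ^ s • cellBasis K n (u, σ) ∈
      cellSpan K {b | b ∈ P.D ∧ P.rank (P.gen b) < P.rank u} σ.card)
    {i : ℕ} (hcyc : ∀ u ∈ P.gens, ∀ σ ⊆ P.free u, σ.card = i → polyD K (ζ u σ) = 0)
    {x : ExteriorAlgebra (MvPolynomial (Fin n) K) (Fin n → MvPolynomial (Fin n) K)}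
    (hx : x ∈ cellSpan K P.D i) (hdx : polyD K x = 0) :
    x ∈ (cellSpan K P.D (i + 1)).map (polyD K) ⊔
      Submodule.span K {z | ∃ u ∈ P.gens, ∃ σ ⊆ P.free u, σ.card = i ∧ ζ u σ = z} := by
  have hx' : x ∈ P.upperSpan K i ⊔ ((cellSpan K P.D (i + 1)).map (polyD K) ⊔
      Submodule.span K {z | ∃ u ∈ P.gens, ∃ σ ⊆ P.free u, σ.card = i ∧ ζ u σ = z}) := by
    rw [← sup_assoc]
    refine (Submodule.span_le.mpr ?_ : cellSpan K _ _ ≤ _) hx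
    rintro _ ⟨⟨b, A⟩, ⟨h1, h2⟩, rfl⟩
    exact P.cellBasis_mem_sup ζ hζ b h1 A i h2
  obtain ⟨y, hy, z, hz, rfl⟩ := Submodule.mem_sup.mp hx'
  have hdz : polyD K z = 0 := by
    refine (show _ ≤ LinearMap.ker (polyD K) from sup_le ?_ (Submodule.span_le.mpr ?_)) hz
    · rintro _ ⟨w, -, rfl⟩
      exact polyD_polyD w
    · rintro _ ⟨u, hu, σ, hσ, hi, rfl⟩
      exact hcyc u hu σ hσ hi
  have hdy : polyD K y = 0 := by
    rwa [map_add, hdz, add_zero] at hdx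
  rw [P.eq_zero_of_mem_upperSpan hy hdy, zero_add]
  exact hz

end StanleyDecomposition

/-- The Koszul complex of the polynomial ring is exact in positive degrees: the set of all
monomials is a single piece without free variables. -/
theorem exists_polyD_eq {K : Type*} [Field K] {n i : ℕ} (hi : i ≠ 0)
    {x : ExteriorAlgebra (MvPolynomial (Fin n) K) (Fin n → MvPolynomial (Fin n) K)}
    (hx : x ∈ cellSpan K Set.univ i) (hdx : polyD K x = 0) :
    ∃ y ∈ cellSpan K Set.univ (i + 1), polyD K y = x := by
  let P : StanleyDecomposition n :=
    { D := Set.univ, gens := {0}, free := fun _ => ∅, gen := fun _ => 0, rank := fun _ => 0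
      add_single_mem := fun _ _ _ => trivial
      gen_mem := fun _ _ => rfl
      gen_le := fun _ _ => zero_le
      notMem_free := fun _ _ _ _ => Finset.notMem_empty _
      add_mem := fun _ _ _ _ => trivial
      gen_add := fun _ hu _ _ => hu.symm
      rank_lt := fun _ _ k hk => absurd hk (Finset.notMem_empty k) }
  have h := P.mem_sup_of_cycle (K := K) (i := i) (x := x) (fun u σ => cellBasis K n (u, σ))
    (fun u _ σ _ => ⟨0, by simp⟩) ?_ hx hdx
  · have h0 : {z | ∃ u ∈ P.gens, ∃ σ ⊆ P.free u, σ.card = i ∧ cellBasis K n (u, σ) = z} = ∅ := by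
      refine Set.eq_empty_of_forall_notMem ?_
      rintro z ⟨u, -, σ, hσ, hc, -⟩
      rw [Finset.subset_empty.mp hσ, Finset.card_empty] at hc
      exact hi hc.symm
    rw [h0, Submodule.span_empty, sup_bot_eq] at h
    exact h
  · intro u _ σ hσ hc
    rw [Finset.subset_empty.mp hσ, Finset.card_empty] at hc
    exact absurd hc.symm hi

/-! ### The lexicographic decomposition of the ideal -/

section Decomposition

variable {K : Type*} [Field K] {n d : ℕ} {t : Fin (d - 1) → ℕ}
  {I : Ideal (MvPolynomial (Fin n) K)}

theorem exists_lex_max_minGens (hI : IsSpreadIdeal t I) {b : Fin n →₀ ℕ}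
    (hb : monomial b (1 : K) ∈ I) :
    ∃ u, (u ∈ minGens I ∧ u ≤ b) ∧ ∀ v ∈ minGens I, v ≤ b → toLex v ≤ toLex u := by
  obtain ⟨u, hu, hmax⟩ := Set.exists_max_image {u | u ∈ minGens I ∧ u ≤ b} toLex
    ((finite_minGens hI).subset fun _ h => h.1) (exists_minGens_le hb)
  exact ⟨u, hu, fun v hv hvb => hmax v ⟨hv, hvb⟩⟩

open Classical in
/-- The lexicographically largest minimal generator dividing a monomial of `I`. -/
def lexGen (I : Ideal (MvPolynomial (Fin n) K)) (b : Fin n →₀ ℕ) : Fin n →₀ ℕ :=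
  if h : ∃ u, (u ∈ minGens I ∧ u ≤ b) ∧ ∀ v ∈ minGens I, v ≤ b → toLex v ≤ toLex u then h.choose
  else 0

theorem lexGen_spec (hI : IsSpreadIdeal t I) {b : Fin n →₀ ℕ} (hb : monomial b (1 : K) ∈ I) :
    (lexGen I b ∈ minGens I ∧ lexGen I b ≤ b) ∧
      ∀ v ∈ minGens I, v ≤ b → toLex v ≤ toLex (lexGen I b) := by
  have h := exists_lex_max_minGens hI hb
  rw [lexGen, dif_pos h]
  exact h.choose_spec

/-- The number of minimal generators that are lexicographically larger than `u`. -/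
def lexRank (I : Ideal (MvPolynomial (Fin n) K)) (u : Fin n →₀ ℕ) : ℕ :=
  {v | v ∈ minGens I ∧ toLex u < toLex v}.ncard

theorem lexRank_lt (hI : IsSpreadIdeal t I) {u v : Fin n →₀ ℕ} (hv : v ∈ minGens I)
    (h : toLex u < toLex v) : lexRank I v < lexRank I u := by
  refine Set.ncard_lt_ncard ⟨fun w hw => ⟨hw.1, h.trans hw.2⟩, fun hsub => ?_⟩
    ((finite_minGens hI).subset fun _ h => h.1)
  exact lt_irrefl _ (hsub ⟨hv, h⟩ : v ∈ minGens I ∧ toLex v < toLex v).2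

variable [NeZero n]

/-- The decomposition of the set of monomials of a `t`-spread strongly stable ideal that assigns to
a monomial its lexicographically largest divisor in `G(I)`. -/
def lexDecomposition (hI : IsSpreadStronglyStable t I) (htop : I ≠ ⊤) :
    StanleyDecomposition n where
  D := {b | monomial b (1 : K) ∈ I}
  gens := minGens I
  free := freeVars t
  gen := lexGen I
  rank := lexRank I
  add_single_mem b hb k := monomial_mem_of_le (le_add_of_nonneg_right zero_le) hb
  gen_mem b hb := (lexGen_spec hI.1 hb).1.1
  gen_le b hb := (lexGen_spec hI.1 hb).1.2
  notMem_free b hb j hj := notMem_freeVars_of_max hI htop (lexGen_spec hI.1 hb).1.1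
    (lexGen_spec hI.1 hb).1.2 (lexGen_spec hI.1 hb).2 hj
  add_mem u hu w _ := monomial_mem_of_le (le_add_of_nonneg_right zero_le) hu.1
  gen_add u hu w hw := by
    have hle : u ≤ u + w := le_add_of_nonneg_right zero_le
    obtain ⟨⟨h1, h2⟩, h3⟩ := lexGen_spec hI.1 (monomial_mem_of_le hle hu.1)
    exact toLex.injective
      (le_antisymm (toLex_le_of_free hI hu h1 hw h2) (h3 u hu hle))
  rank_lt b hb k hk := by
    have hle : b ≤ b + Finsupp.single k 1 := le_add_of_nonneg_right zero_le
    obtain ⟨⟨h1, h2⟩, -⟩ := lexGen_spec hI.1 hb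
    obtain ⟨⟨h1', h2'⟩, h3'⟩ := lexGen_spec hI.1 (monomial_mem_of_le hle hb)
    refine lexRank_lt hI.1 h1' (lt_of_le_of_ne (h3' _ h1 (h2.trans hle)) fun h => ?_)
    -- otherwise the free variable `x_k` would divide `x^b x_k / x^u`
    have h' := toLex.injective h
    refine notMem_freeVars_of_max hI htop h1' h2' h3' (k := k) ?_ (h' ▸ hk)
    rw [← h', Finsupp.mem_support_iff, Finsupp.tsub_apply, Finsupp.add_apply,
      Finsupp.single_eq_same]
    have := h2 k
    omega

end Decomposition

/-! ### Lifts of the cycles to the polynomial ring -/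

section PolyCycle

variable {K : Type*} [Field K] {n : ℕ}

theorem prod_map_X_sort (A : Finset (Fin n)) (g : Fin n → Fin n) :
    (((A.sort (· ≤ ·)).map g).map (X : Fin n → MvPolynomial (Fin n) K)).prod
      = monomial (∑ k ∈ A, Finsupp.single (g k) 1) 1 := by
  rw [List.map_map, ← List.prod_toFinset _ (Finset.sort_nodup _ _), Finset.sort_toFinset,
    monomial_sum_one]
  rfl

theorem injOn_nextVar_of_nodup {u : Fin n →₀ ℕ} {F : Finset (Fin n)}
    (h : ((F.sort (· ≤ ·)).map (nextVar u)).Nodup) : Set.InjOn (nextVar u) F := by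
  intro a ha b hb hab
  exact List.inj_on_of_nodup_map h ((Finset.mem_sort _).mpr ha) ((Finset.mem_sort _).mpr hb) hab

theorem koszulScale_wedge_mul_wedge (u : Fin n →₀ ℕ) (σ F : Finset (Fin n)) :
    koszulScale X (koszulWedge (MvPolynomial (Fin n) K) ((σ \ F).sort (· ≤ ·)) *
        koszulWedge _ ((F.sort (· ≤ ·)).map (nextVar u)))
      = monomial (∑ k ∈ σ \ F, Finsupp.single k 1 + ∑ k ∈ F, Finsupp.single (nextVar u k) 1)
          (1 : K) • (koszulWedge (MvPolynomial (Fin n) K) ((σ \ F).sort (· ≤ ·)) *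
        koszulWedge _ ((F.sort (· ≤ ·)).map (nextVar u))) := by
  rw [map_mul, koszulScale_koszulWedge, koszulScale_koszulWedge, smul_mul_smul_comm,
    prod_map_X_sort]
  have h := prod_map_X_sort (K := K) (σ \ F) id
  rw [List.map_id] at h
  rw [h, monomial_mul, one_mul]
  rfl

variable (K) [NeZero n]

/-- The lift of `e(u; σ)` to the Koszul complex of the polynomial ring. -/
def polyCycle (u : Fin n →₀ ℕ) (σ : Finset (Fin n)) :
    ExteriorAlgebra (MvPolynomial (Fin n) K) (Fin n → MvPolynomial (Fin n) K) :=
  ∑ F ∈ σ.powerset, (-1 : MvPolynomial (Fin n) K) ^ signExp u σ F •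
    monomial (cycleCoeff u F) (1 : K) •
      (koszulWedge _ ((σ \ F).sort (· ≤ ·)) *
        koszulWedge _ ((F.sort (· ≤ ·)).map (nextVar u)) * koszulE _ (maxVar u))

variable {K}

theorem wedge_mul_wedge_mem (R : Type*) [CommRing R] (u : Fin n →₀ ℕ) {σ F : Finset (Fin n)}
    (hF : F ⊆ σ) : koszulWedge R ((σ \ F).sort (· ≤ ·)) *
        koszulWedge R ((F.sort (· ≤ ·)).map (nextVar u)) * koszulE R (maxVar u) ∈
      ⋀[R]^(σ.card + 1) (Fin n → R) := by
  rw [← koszulWedge_append, ← koszulWedge_singleton, ← koszulWedge_append]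
  have h := koszulWedge_mem R ((σ \ F).sort (· ≤ ·) ++ (F.sort (· ≤ ·)).map (nextVar u) ++
    [maxVar u])
  rw [List.length_append, List.length_append, List.length_map, Finset.length_sort,
    Finset.length_sort, Finset.card_sdiff_add_card_eq_card hF] at h
  exact h

theorem polyCycle_mem (u : Fin n →₀ ℕ) (σ : Finset (Fin n)) : polyCycle K u σ ∈
    ⋀[MvPolynomial (Fin n) K]^(σ.card + 1) (Fin n → MvPolynomial (Fin n) K) :=
  Submodule.sum_mem _ fun _ hF => Submodule.smul_mem _ _ <| Submodule.smul_mem _ _ <|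
    wedge_mul_wedge_mem _ u (Finset.mem_powerset.mp hF)

theorem cycleE_mem (I : Ideal (MvPolynomial (Fin n) K)) (u : Fin n →₀ ℕ) (σ : Finset (Fin n)) :
    cycleE I u σ ∈
      ⋀[MvPolynomial (Fin n) K ⧸ I]^(σ.card + 1) (Fin n → MvPolynomial (Fin n) K ⧸ I) :=
  Submodule.sum_mem _ fun _ hF => Submodule.smul_mem _ _ <| Submodule.smul_mem _ _ <|
    wedge_mul_wedge_mem _ u (Finset.mem_powerset.mp hF)

theorem koszulBaseChange_polyCycle (I : Ideal (MvPolynomial (Fin n) K)) (u : Fin n →₀ ℕ)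
    (σ : Finset (Fin n)) :
    koszulBaseChange (MvPolynomial (Fin n) K ⧸ I) (polyCycle K u σ) = cycleE I u σ := by
  have hs : ∀ (r : MvPolynomial (Fin n) K) (y : ExteriorAlgebra (MvPolynomial (Fin n) K ⧸ I)
      (Fin n → MvPolynomial (Fin n) K ⧸ I)), r • y = Ideal.Quotient.mk I r • y :=
    fun r y => (algebraMap_smul (MvPolynomial (Fin n) K ⧸ I) r y).symm
  rw [polyCycle, map_sum, cycleE]
  refine Finset.sum_congr rfl fun F _ => ?_
  rw [map_smul, map_smul, map_mul, map_mul, koszulBaseChange_koszulWedge,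
    koszulBaseChange_koszulWedge, koszulBaseChange_koszulE, hs, hs, map_pow, map_neg, map_one]

/-- Rescaling turns the lift of `e(u; σ)` into `x^u x_σ ∏_{k ∈ σ} (e_k - e_{k^{(u)}}) ∧ e_{max(u)}`,
all of whose factors but the last are cycles for the sequence `1, …, 1`. -/
theorem koszulScale_polyCycle {u : Fin n →₀ ℕ} (hu : u ≠ 0) {σ : Finset (Fin n)}
    (hσ : ∀ k ∈ σ, k < maxVar u) :
    koszulScale X (polyCycle K u σ)
      = monomial (u + ∑ k ∈ σ, Finsupp.single k 1) (1 : K) •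
        (((σ.sort (· ≤ ·)).map fun k =>
          koszulE (MvPolynomial (Fin n) K) k - koszulE _ (nextVar u k)).prod *
            koszulE _ (maxVar u)) := by
  rw [prod_koszulE_sub _ (maxVar_mem hu) σ hσ, polyCycle, map_sum, Finset.sum_mul,
    Finset.smul_sum]
  refine Finset.sum_congr rfl fun F hF => ?_
  rw [Finset.mem_powerset] at hF
  rw [map_smul, map_smul, map_mul, koszulScale_wedge_mul_wedge u σ F, koszulScale_koszulE,
    smul_mul_smul_comm, smul_mul_assoc, smul_comm (monomial _ _) ((-1) ^ _)]
  congr 1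
  by_cases hnd : ((F.sort (· ≤ ·)).map (nextVar u) ++ [maxVar u]).Nodup
  · rw [List.nodup_append] at hnd
    have hinj := injOn_nextVar_of_nodup hnd.1
    have hmax : ∀ k ∈ F, nextVar u k ≠ maxVar u := fun k hk =>
      hnd.2.2 _ (List.mem_map_of_mem ((Finset.mem_sort _).mpr hk)) _ (by simp)
    have hle := sum_single_nextVar_le hu (fun k hk => hσ k (hF hk)) hinj
    rw [smul_smul, X, monomial_mul, monomial_mul, one_mul, one_mul]
    congr 3
    rw [cycleCoeff, ← Finset.sum_sdiff hF]
    ext i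
    have h1 := hle i
    have h2 := Finsupp.mem_support_iff.mp (maxVar_mem hu)
    simp only [Finsupp.add_apply, Finsupp.tsub_apply]
    by_cases hi : i = maxVar u
    · have h0 : (∑ k ∈ F, Finsupp.single (nextVar u k) 1) i = 0 := by
        rw [Finsupp.finsetSum_apply]
        exact Finset.sum_eq_zero fun k hk =>
          Finsupp.single_eq_of_ne (hi ▸ (hmax k hk).symm)
      rw [h0, hi, Finsupp.single_eq_same]
      omega
    · rw [Finsupp.single_eq_of_ne hi]
      omega
  · have h0 : koszulWedge (MvPolynomial (Fin n) K) ((F.sort (· ≤ ·)).map (nextVar u)) *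
        koszulE _ (maxVar u) = 0 := by
      rw [← koszulWedge_singleton, ← koszulWedge_append]
      exact koszulWedge_eq_zero _ hnd
    rw [mul_assoc, h0, mul_zero, smul_zero, smul_zero, smul_zero]

/-- The boundary of the lift of `e(u; σ)`. -/
theorem koszulD_polyCycle {u : Fin n →₀ ℕ} (hu : u ≠ 0) {σ : Finset (Fin n)}
    (hσ : ∀ k ∈ σ, k < maxVar u) :
    koszulD X (polyCycle K u σ) = (-1 : MvPolynomial (Fin n) K) ^ σ.card •
      ∑ F ∈ σ.powerset, (-1 : MvPolynomial (Fin n) K) ^ signExp u σ F •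
        monomial (exchange u F) (1 : K) • (koszulWedge _ ((σ \ F).sort (· ≤ ·)) *
          koszulWedge _ ((F.sort (· ≤ ·)).map (nextVar u))) := by
  refine koszulScale_injective (f := X) (fun j => X_ne_zero j) ?_
  have hE : koszulD (1 : Fin n → MvPolynomial (Fin n) K) (koszulE _ (maxVar u)) = 1 := by
    have h := koszulD_koszulE_mul (1 : Fin n → MvPolynomial (Fin n) K) (maxVar u) 1
    rwa [mul_one, koszulD_one, mul_zero, sub_zero, Pi.one_apply, one_smul] at h
  rw [koszulScale_koszulD, koszulScale_polyCycle hu hσ, map_smul, koszulD_prod_sub, hE, mul_one,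
    Finset.length_sort, prod_koszulE_sub _ (maxVar_mem hu) σ hσ, map_smul, map_sum,
    smul_comm (monomial _ _) ((-1) ^ _), Finset.smul_sum]
  congr 1
  refine Finset.sum_congr rfl fun F hF => ?_
  rw [Finset.mem_powerset] at hF
  rw [map_smul, map_smul, koszulScale_wedge_mul_wedge u σ F, smul_comm (monomial _ _) ((-1) ^ _)]
  congr 1
  by_cases hnd : ((F.sort (· ≤ ·)).map (nextVar u)).Nodup
  · have h := exchange_add hu (fun k hk => hσ k (hF hk)) (injOn_nextVar_of_nodup hnd)
    rw [smul_smul, monomial_mul, one_mul]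
    congr 3
    rw [add_left_comm, h, ← Finset.sum_sdiff hF]
    abel
  · rw [koszulWedge_eq_zero _ hnd, mul_zero, smul_zero, smul_zero, smul_zero]

/-- The boundary of the lift of `e(u; σ)` has the term `± x^u e_σ`, and its other terms belong to
the monomials `x_F (u / x_{F^{(u)}})` with `F` nonempty. -/
theorem polyD_polyCycle_sub_mem {u : Fin n →₀ ℕ} (hu : u ≠ 0) {σ : Finset (Fin n)}
    (hσ : ∀ k ∈ σ, k < maxVar u) :
    polyD K (polyCycle K u σ) - (-1 : K) ^ σ.card • cellBasis K n (u, σ) ∈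
      cellSpan K {b | ∃ F ⊆ σ, F.Nonempty ∧ Set.InjOn (nextVar u) F ∧ exchange u F = b}
        σ.card := by
  have hs : ∀ (c : ℕ) (y : ExteriorAlgebra (MvPolynomial (Fin n) K)
      (Fin n → MvPolynomial (Fin n) K)),
      (-1 : MvPolynomial (Fin n) K) ^ c • y = (-1 : K) ^ c • y := fun c y => by
    rw [← algebraMap_smul (MvPolynomial (Fin n) K) ((-1 : K) ^ c), map_pow, map_neg,
      RingHom.map_one]
  have h0 : (-1 : MvPolynomial (Fin n) K) ^ signExp u σ ∅ •
        monomial (exchange u ∅) (1 : K) • (koszulWedge _ ((σ \ ∅).sort (· ≤ ·)) *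
          koszulWedge _ (((∅ : Finset (Fin n)).sort (· ≤ ·)).map (nextVar u)))
      = cellBasis K n (u, σ) := by
    rw [signExp_empty, pow_zero, one_smul, cellBasis_apply, wedgeBasis_apply, Finset.sdiff_empty,
      Finset.sort_empty, List.map_nil, koszulWedge_nil, mul_one, exchange, Finset.sum_empty,
      Finset.sum_empty, zero_add, tsub_zero]
  change koszulD X _ - _ ∈ _
  rw [koszulD_polyCycle hu hσ, ← Finset.add_sum_erase _ _ (Finset.empty_mem_powerset σ), h0,
    hs, smul_add, add_sub_cancel_left]
  refine Submodule.smul_mem _ _ (Submodule.sum_mem _ fun F hF => ?_)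
  rw [Finset.mem_erase, Finset.mem_powerset] at hF
  rw [hs]
  refine Submodule.smul_mem _ _ ?_
  rw [← koszulWedge_append]
  by_cases hnd : ((σ \ F).sort (· ≤ ·) ++ (F.sort (· ≤ ·)).map (nextVar u)).Nodup
  · obtain ⟨s, hsort⟩ := koszulWedge_eq_sort (MvPolynomial (Fin n) K) hnd
    rw [hsort, smul_comm, hs, ← wedgeBasis_apply, ← cellBasis_apply]
    have hb : exchange u F ∈
        {b | ∃ F ⊆ σ, F.Nonempty ∧ Set.InjOn (nextVar u) F ∧ exchange u F = b} :=
      ⟨F, hF.2, Finset.nonempty_iff_ne_empty.mpr hF.1,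
        injOn_nextVar_of_nodup (List.nodup_append.mp hnd).2.1, rfl⟩
    refine Submodule.smul_mem _ _ (cellBasis_mem_cellSpan hb ?_)
    rw [List.toFinset_card_of_nodup hnd, List.length_append, List.length_map, Finset.length_sort,
      Finset.length_sort, Finset.card_sdiff_add_card_eq_card hF.2]
  · rw [koszulWedge_eq_zero _ hnd, smul_zero]
    exact Submodule.zero_mem _

end PolyCycle

/-! ### Reduction modulo the ideal -/

section Reduction

variable {K : Type*} [Field K] {n : ℕ} {I : Ideal (MvPolynomial (Fin n) K)}

theorem mem_exteriorPower_iff_mem_cellSpan {i : ℕ}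
    {x : ExteriorAlgebra (MvPolynomial (Fin n) K) (Fin n → MvPolynomial (Fin n) K)} :
    x ∈ ⋀[MvPolynomial (Fin n) K]^i (Fin n → MvPolynomial (Fin n) K) ↔
      x ∈ cellSpan K Set.univ i := by
  rw [mem_exteriorPower_iff, mem_cellSpan]
  simp only [cellBasis_repr, Set.mem_univ, true_and]
  constructor
  · intro h b A hbA
    exact h A fun h0 => hbA (by rw [h0, coeff_zero])
  · intro h A hA
    obtain ⟨b, hb⟩ := ne_zero_iff.mp hA
    exact h b A hb

theorem cellSpan_mono {D D' : Set (Fin n →₀ ℕ)} (h : D ⊆ D') (i : ℕ) :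
    cellSpan K D i ≤ cellSpan K D' i :=
  Submodule.span_mono (Set.image_mono fun _ hp => ⟨h hp.1, hp.2⟩)

theorem monomial_mem_of_mem_support (hI : IsMonomialIdeal I) {p : MvPolynomial (Fin n) K}
    (hp : p ∈ I) {b : Fin n →₀ ℕ} (hb : coeff b p ≠ 0) : monomial b (1 : K) ∈ I := by
  obtain ⟨A, rfl⟩ := hI
  obtain ⟨a, ha, hab⟩ := mem_ideal_span_monomial_image.mp hp b (mem_support_iff.mpr hb)
  exact monomial_mem_of_le hab (Ideal.subset_span ⟨a, ha, rfl⟩)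

/-- The Koszul complex of a monomial ideal `I` is the kernel of the reduction modulo `I`. -/
theorem mem_cellSpan_iff_koszulBaseChange_eq_zero (hI : IsMonomialIdeal I) {i : ℕ}
    {x : ExteriorAlgebra (MvPolynomial (Fin n) K) (Fin n → MvPolynomial (Fin n) K)} :
    x ∈ cellSpan K {b | monomial b (1 : K) ∈ I} i ↔ x ∈ cellSpan K Set.univ i ∧
      koszulBaseChange (MvPolynomial (Fin n) K ⧸ I) x = 0 := by
  have hker : koszulBaseChange (MvPolynomial (Fin n) K ⧸ I) x = 0 ↔
      ∀ A, (wedgeBasis (MvPolynomial (Fin n) K) n).repr x A ∈ I := by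
    rw [← (wedgeBasis (MvPolynomial (Fin n) K ⧸ I) n).forall_coord_eq_zero_iff]
    refine forall_congr' fun A => ?_
    rw [Module.Basis.coord_apply, wedgeBasis_repr_koszulBaseChange]
    exact Ideal.Quotient.eq_zero_iff_mem
  rw [hker]
  constructor
  · refine fun h => ⟨cellSpan_mono (Set.subset_univ _) i h, fun A => ?_⟩
    rw [as_sum ((wedgeBasis (MvPolynomial (Fin n) K) n).repr x A)]
    refine I.sum_mem fun b hb => ?_
    have h1 := (mem_cellSpan.mp h b A (by rwa [cellBasis_repr, ← mem_support_iff])).1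
    rw [← mul_one (coeff b _), ← C_mul_monomial]
    exact I.mul_mem_left _ h1
  · rintro ⟨h1, h2⟩
    rw [mem_cellSpan] at h1 ⊢
    refine fun b A hbA => ⟨?_, (h1 b A hbA).2⟩
    rw [cellBasis_repr] at hbA
    exact monomial_mem_of_mem_support hI (h2 A) hbA

/-- A boundary in the Koszul complex of `I` has no terms `x^u e_σ` with `u ∈ G(I)`. -/
theorem repr_polyD_eq_zero_of_minGens {i : ℕ} {u : Fin n →₀ ℕ} (hu : u ∈ minGens I)
    (σ : Finset (Fin n))
    {x : ExteriorAlgebra (MvPolynomial (Fin n) K) (Fin n → MvPolynomial (Fin n) K)}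
    (hx : x ∈ cellSpan K {b | monomial b (1 : K) ∈ I} i) :
    (cellBasis K n).repr (polyD K x) (u, σ) = 0 := by
  refine (Submodule.span_le.mpr ?_ : cellSpan K _ i ≤ LinearMap.ker
    (((cellBasis K n).coord (u, σ)).comp (polyD K))) hx
  rintro _ ⟨⟨b, A⟩, ⟨hb, -⟩, rfl⟩
  obtain ⟨s, hs⟩ := polyD_cellBasis K b A
  rw [SetLike.mem_coe, LinearMap.mem_ker, LinearMap.comp_apply, hs, map_sum]
  refine Finset.sum_eq_zero fun j _ => ?_
  rw [map_smul, Module.Basis.coord_apply, Module.Basis.repr_self, Finsupp.single_eq_of_ne,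
    smul_zero]
  intro h
  have h1 : u = b + Finsupp.single j 1 := congrArg Prod.fst h
  have h2 : u j ≤ b j := hu.2 hb (h1 ▸ le_add_of_nonneg_right zero_le) j
  rw [h1, Finsupp.add_apply, Finsupp.single_eq_same] at h2
  omega

end Reduction

/-! ### The basis of the Koszul homology -/

section Main

variable {K : Type*} [Field K] {n d : ℕ} {t : Fin (d - 1) → ℕ}
  {I : Ideal (MvPolynomial (Fin n) K)}

theorem koszulBaseChange_smul (c : K)
    (x : ExteriorAlgebra (MvPolynomial (Fin n) K) (Fin n → MvPolynomial (Fin n) K)) :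
    koszulBaseChange (MvPolynomial (Fin n) K ⧸ I) (c • x)
      = c • koszulBaseChange (MvPolynomial (Fin n) K ⧸ I) x :=
  LinearMap.map_smul_of_tower (koszulBaseChange (MvPolynomial (Fin n) K ⧸ I)).toLinearMap c x

theorem koszulBaseChange_polyD
    (x : ExteriorAlgebra (MvPolynomial (Fin n) K) (Fin n → MvPolynomial (Fin n) K)) :
    koszulBaseChange (MvPolynomial (Fin n) K ⧸ I) (polyD K x)
      = koszulD (varSeq I) (koszulBaseChange (MvPolynomial (Fin n) K ⧸ I) x) :=
  koszulBaseChange_koszulD _ _ _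

/-- The homology class of a Koszul cycle as a `K`-linear map. -/
def koszulClassHom (I : Ideal (MvPolynomial (Fin n) K)) (i : ℕ) :
    koszulCycles (varSeq I) i →ₗ[K] KoszulHomology (varSeq I) i :=
  (Submodule.mkQ _).restrictScalars K

theorem koszulClassHom_eq_iff {i : ℕ} {x y : koszulCycles (varSeq I) i} :
    koszulClassHom I i x = koszulClassHom I i y ↔
      x.1 - y.1 ∈ koszulBoundaries (varSeq I) i :=
  Submodule.Quotient.eq _

variable [NeZero n]

/-- All terms of the boundary of the lift of `e(u; σ)` except for `± x^u e_σ` lie in pieces of the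
lexicographic decomposition that come before the piece of `u`. -/
theorem polyD_polyCycle_sub_mem_rank (hI : IsSpreadStronglyStable t I) (htop : I ≠ ⊤)
    {u : Fin n →₀ ℕ} (hu : u ∈ minGens I) {σ : Finset (Fin n)} (hσ : σ ⊆ freeVars t u) :
    polyD K (polyCycle K u σ) - (-1 : K) ^ σ.card • cellBasis K n (u, σ) ∈
      cellSpan K {b | monomial b (1 : K) ∈ I ∧ lexRank I (lexGen I b) < lexRank I u}
        σ.card := by
  refine cellSpan_mono ?_ _ (polyD_polyCycle_sub_mem (minGens_ne_zero htop hu)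
    fun k hk => (mem_freeVars.mp (hσ hk)).1)
  rintro _ ⟨F, hF, hne, hinj, rfl⟩
  obtain ⟨w, hw, hwle, hlt⟩ :=
    exists_minGens_lex_lt_exchange hI htop hu hne (hF.trans hσ) hinj
  have hmem := monomial_mem_of_le hwle hw.1
  obtain ⟨⟨h1, -⟩, h2⟩ := lexGen_spec hI.1 hmem
  exact ⟨hmem, lexRank_lt hI.1 h1 (hlt.trans_le (h2 w hw hwle))⟩

/-- The boundary of the lift of `e(u; σ)` has coefficients in `I`, so `e(u; σ)` is a cycle. -/
theorem polyD_polyCycle_mem (hI : IsSpreadStronglyStable t I) (htop : I ≠ ⊤)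
    {u : Fin n →₀ ℕ} (hu : u ∈ minGens I) {σ : Finset (Fin n)} (hσ : σ ⊆ freeVars t u) :
    polyD K (polyCycle K u σ) ∈ cellSpan K {b | monomial b (1 : K) ∈ I} σ.card := by
  have h1 := cellSpan_mono (fun b hb => hb.1 : _ ⊆ {b | monomial b (1 : K) ∈ I}) _
    (polyD_polyCycle_sub_mem_rank hI htop hu hσ)
  have h2 : (-1 : K) ^ σ.card • cellBasis K n (u, σ) ∈
      cellSpan K {b | monomial b (1 : K) ∈ I} σ.card :=
    Submodule.smul_mem _ _ (cellBasis_mem_cellSpan hu.1 rfl)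
  simpa using Submodule.add_mem _ h1 h2

theorem cycleE_mem_koszulCycles (hI : IsSpreadStronglyStable t I) (htop : I ≠ ⊤) {i : ℕ}
    (hi : 1 ≤ i) (p : CycleIndex t I i) :
    cycleE I p.1.1 p.1.2 ∈ koszulCycles (varSeq I) i := by
  obtain ⟨⟨u, σ⟩, hu, hσ, hc⟩ := p
  refine ⟨?_, ?_⟩
  · have := cycleE_mem I u σ
    rwa [show σ.card + 1 = i by simp only at hc; omega] at this
  · rw [SetLike.mem_coe, LinearMap.mem_ker, ← koszulBaseChange_polyCycle, ← koszulBaseChange_polyD]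
    exact ((mem_cellSpan_iff_koszulBaseChange_eq_zero hI.1.1).mp
      (polyD_polyCycle_mem hI htop hu hσ)).2

/-- If a `K`-linear combination of the `e(u; σ)` is a boundary, then its coefficients vanish: the
corresponding combination of the boundaries of the lifts is a boundary in the Koszul complex of
`I`, so that it has no terms `x^u e_σ` with `u ∈ G(I)`. -/
theorem eq_zero_of_sum_mem_koszulBoundaries (hI : IsSpreadStronglyStable t I) (htop : I ≠ ⊤)
    {i : ℕ} (hi : 1 ≤ i) (s : Finset (CycleIndex t I i)) (c : CycleIndex t I i → K)
    (h : ∑ p ∈ s, c p • cycleE I p.1.1 p.1.2 ∈ koszulBoundaries (varSeq I) i) :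
    ∀ p ∈ s, c p = 0 := by
  classical
  obtain ⟨a, ha, hda⟩ := h
  obtain ⟨y, hy, rfl⟩ := exists_koszulBaseChange_eq (R := MvPolynomial (Fin n) K)
    (MvPolynomial (Fin n) K ⧸ I) Ideal.Quotient.mk_surjective ha
  rw [← koszulBaseChange_polyD] at hda
  set x := ∑ p ∈ s, c p • polyCycle K p.1.1 p.1.2 with hx
  have hxI : x - polyD K y ∈ cellSpan K {b | monomial b (1 : K) ∈ I} i := by
    rw [mem_cellSpan_iff_koszulBaseChange_eq_zero hI.1.1]
    constructor
    · refine Submodule.sub_mem _ (Submodule.sum_mem _ fun p _ => Submodule.smul_mem _ _ ?_) ?_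
      · rw [← mem_exteriorPower_iff_mem_cellSpan]
        have := polyCycle_mem (K := K) p.1.1 p.1.2
        rwa [show p.1.2.card + 1 = i by have := p.2.2.2; omega] at this
      · rw [← mem_exteriorPower_iff_mem_cellSpan]
        exact koszulD_mem _ _ _ hy
    · rw [map_sub, hda, hx, map_sum, sub_eq_zero]
      refine Finset.sum_congr rfl fun p _ => ?_
      rw [koszulBaseChange_smul, koszulBaseChange_polyCycle]
  have hdx : ∀ p : CycleIndex t I i,
      ∑ q ∈ s, c q * (cellBasis K n).repr (polyD K (polyCycle K q.1.1 q.1.2)) p.1 = 0 := by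
    intro p
    have h := repr_polyD_eq_zero_of_minGens p.2.1 p.1.2 hxI
    rw [map_sub, polyD_polyD, sub_zero, hx, map_sum, map_sum,
      Finsupp.finsetSum_apply] at h
    simpa only [map_smul, Finsupp.smul_apply, smul_eq_mul] using h
  by_contra hcon
  push Not at hcon
  obtain ⟨p, hp, hcp⟩ := hcon
  -- Among the pairs with nonzero coefficient, choose one whose generator has maximal weight.
  obtain ⟨p, hp, hmax⟩ := Finset.exists_max_image (s.filter fun q => c q ≠ 0)
    (fun q => indexWeight q.1.1) ⟨p, Finset.mem_filter.mpr ⟨hp, hcp⟩⟩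
  rw [Finset.mem_filter] at hp
  have hrepr : ∀ q : CycleIndex t I i, indexWeight q.1.1 ≤ indexWeight p.1.1 →
      (cellBasis K n).repr (polyD K (polyCycle K q.1.1 q.1.2)) p.1
        = if q = p then (-1 : K) ^ q.1.2.card else 0 := by
    intro q hq
    have hu0 := minGens_ne_zero htop q.2.1
    have hσ : ∀ k ∈ q.1.2, k < maxVar q.1.1 := fun k hk => (mem_freeVars.mp (q.2.2.1 hk)).1
    have h0 : (cellBasis K n).repr (polyD K (polyCycle K q.1.1 q.1.2)
        - (-1 : K) ^ q.1.2.card • cellBasis K n q.1) p.1 = 0 := by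
      by_contra hne
      obtain ⟨⟨F, hF, hFne, hinj, hFe⟩, -⟩ :=
        mem_cellSpan.mp (polyD_polyCycle_sub_mem hu0 hσ) p.1.1 p.1.2 hne
      have := indexWeight_exchange_lt hu0 hFne (fun k hk => hσ k (hF hk)) hinj
      rw [hFe] at this
      omega
    rw [map_sub, Finsupp.sub_apply, sub_eq_zero] at h0
    rw [h0, map_smul, Module.Basis.repr_self, Finsupp.smul_apply, Finsupp.single_apply]
    by_cases hqp : q = p
    · rw [if_pos (congrArg Subtype.val hqp), if_pos hqp, smul_eq_mul, mul_one]
    · rw [if_neg fun h => hqp (Subtype.ext h), if_neg hqp, smul_zero]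
  have h1 := hdx p
  rw [Finset.sum_eq_single_of_mem p hp.1 fun q hq hqp => ?_, hrepr p le_rfl, if_pos rfl] at h1
  · exact (mul_ne_zero hp.2 (pow_ne_zero _ (neg_ne_zero.mpr one_ne_zero))) h1
  · by_cases hcq : c q = 0
    · rw [hcq, zero_mul]
    · rw [hrepr q (hmax q (Finset.mem_filter.mpr ⟨hq, hcq⟩)), if_neg hqp, mul_zero]

/-- Every cycle is homologous to a `K`-linear combination of the `e(u; σ)`. -/
theorem exists_sub_mem_koszulBoundaries (hI : IsSpreadStronglyStable t I) (htop : I ≠ ⊤)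
    {i : ℕ} (hi : 1 ≤ i)
    {a : ExteriorAlgebra (MvPolynomial (Fin n) K ⧸ I) (Fin n → MvPolynomial (Fin n) K ⧸ I)}
    (ha : a ∈ koszulCycles (varSeq I) i) :
    ∃ z ∈ Submodule.span K (Set.range fun p : CycleIndex t I i => cycleE I p.1.1 p.1.2),
      a - z ∈ koszulBoundaries (varSeq I) i := by
  obtain ⟨ha, hda⟩ := ha
  obtain ⟨x, hx, rfl⟩ := exists_koszulBaseChange_eq (R := MvPolynomial (Fin n) K)
    (MvPolynomial (Fin n) K ⧸ I) Ideal.Quotient.mk_surjective ha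
  rw [SetLike.mem_coe, LinearMap.mem_ker, ← koszulBaseChange_polyD] at hda
  obtain ⟨i, rfl⟩ : ∃ j, i = j + 1 := ⟨i - 1, by omega⟩
  -- The connecting homomorphism: the boundary of a lift is a cycle in the Koszul complex of `I`.
  have hdx : polyD K x ∈ cellSpan K {b | monomial b (1 : K) ∈ I} i := by
    rw [mem_cellSpan_iff_koszulBaseChange_eq_zero hI.1.1]
    exact ⟨mem_exteriorPower_iff_mem_cellSpan.mp (koszulD_mem _ _ _ hx), hda⟩
  have hsup := (lexDecomposition hI htop).mem_sup_of_cycle (K := K)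
    (fun u σ => polyD K (polyCycle K u σ))
    (fun u hu σ hσ => ⟨σ.card, polyD_polyCycle_sub_mem_rank hI htop hu hσ⟩)
    (fun _ _ _ _ _ => polyD_polyD _) hdx
    (polyD_polyD x)
  obtain ⟨_, ⟨w, hw, rfl⟩, z, hz, hsum⟩ := Submodule.mem_sup.mp hsup
  obtain ⟨z, hz', rfl⟩ : ∃ z' ∈ Submodule.span K
      (Set.range fun p : CycleIndex t I (i + 1) => polyCycle K p.1.1 p.1.2),
      polyD K z' = z := by
    rw [← Submodule.mem_map, Submodule.map_span]
    refine Submodule.span_mono ?_ hz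
    rintro _ ⟨u, hu, σ, hσ, hc, rfl⟩
    exact ⟨_, ⟨⟨(u, σ), hu, hσ, hc⟩, rfl⟩, rfl⟩
  have hz'' : z ∈ cellSpan K Set.univ (i + 1) := by
    refine (Submodule.span_le.mpr ?_ : _ ≤ cellSpan K Set.univ (i + 1)) hz'
    rintro _ ⟨p, rfl⟩
    have h := polyCycle_mem (K := K) p.1.1 p.1.2
    rw [p.2.2.2] at h
    exact mem_exteriorPower_iff_mem_cellSpan.mp h
  obtain ⟨hw1, hw2⟩ := (mem_cellSpan_iff_koszulBaseChange_eq_zero hI.1.1).mp hw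
  obtain ⟨y, hy, hdy⟩ := exists_polyD_eq (Nat.succ_ne_zero i)
    (Submodule.sub_mem _ (Submodule.sub_mem _
      (mem_exteriorPower_iff_mem_cellSpan.mp hx) hz'') hw1)
    (by rw [map_sub, map_sub, ← hsum]; abel)
  refine ⟨koszulBaseChange (MvPolynomial (Fin n) K ⧸ I) z, ?_,
    koszulBaseChange (MvPolynomial (Fin n) K ⧸ I) y, ?_, ?_⟩
  · have h := Submodule.mem_map_of_mem
      (f := (koszulBaseChange (MvPolynomial (Fin n) K ⧸ I)).toLinearMap.restrictScalars K) hz'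
    rw [Submodule.map_span, ← Set.range_comp] at h
    refine Submodule.span_mono ?_ h
    rintro _ ⟨p, rfl⟩
    exact ⟨p, (koszulBaseChange_polyCycle I _ _).symm⟩
  · rw [SetLike.mem_coe, mem_exteriorPower_iff]
    intro A hA
    rw [wedgeBasis_repr_koszulBaseChange] at hA
    exact (mem_exteriorPower_iff _).mp (mem_exteriorPower_iff_mem_cellSpan.mpr hy) A
      fun h0 => hA (by rw [h0, map_zero])
  · rw [← koszulBaseChange_polyD, hdy, map_sub, map_sub, hw2, sub_zero]

/-- The cycle `e(u; σ)`. -/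
def cycleOf (hI : IsSpreadStronglyStable t I) (htop : I ≠ ⊤) {i : ℕ} (hi : 1 ≤ i)
    (p : CycleIndex t I i) : koszulCycles (varSeq I) i :=
  ⟨cycleE I p.1.1 p.1.2, cycleE_mem_koszulCycles hI htop hi p⟩

theorem linearIndependent_koszulClassHom (hI : IsSpreadStronglyStable t I) (htop : I ≠ ⊤) {i : ℕ}
    (hi : 1 ≤ i) :
    LinearIndependent K fun p => koszulClassHom I i (cycleOf hI htop hi p) := by
  rw [linearIndependent_iff']
  intro s c hsum
  refine eq_zero_of_sum_mem_koszulBoundaries hI htop hi s c ?_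
  have h : koszulClassHom I i (∑ p ∈ s, c p • cycleOf hI htop hi p) = koszulClassHom I i 0 := by
    rw [map_sum, map_zero, ← hsum]
    exact Finset.sum_congr rfl fun p _ => map_smul (koszulClassHom I i) _ _
  rw [koszulClassHom_eq_iff, Submodule.coe_zero, sub_zero, AddSubmonoidClass.coe_finsetSum] at h
  exact h

theorem span_koszulClassHom_eq_top (hI : IsSpreadStronglyStable t I) (htop : I ≠ ⊤) {i : ℕ}
    (hi : 1 ≤ i) :
    Submodule.span K (Set.range fun p => koszulClassHom I i (cycleOf hI htop hi p)) = ⊤ := by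
  rw [eq_top_iff]
  rintro h -
  obtain ⟨a, rfl⟩ : ∃ a, koszulClassHom I i a = h := Submodule.mkQ_surjective _ h
  obtain ⟨z, hz, hza⟩ := exists_sub_mem_koszulBoundaries hI htop hi a.2
  obtain ⟨y, hye, rfl⟩ : ∃ y ∈ Submodule.span K (Set.range (cycleOf hI htop hi)), y.1 = z := by
    have hmap := Submodule.map_span ((koszulCycles (varSeq I) i).subtype.restrictScalars K)
      (Set.range (cycleOf hI htop hi))
    rw [← Set.range_comp] at hmap
    exact Submodule.mem_map.mp (hmap ▸ hz)
  have hmem := Submodule.mem_map_of_mem (f := koszulClassHom I i) hye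
  rw [Submodule.map_span, ← Set.range_comp] at hmem
  rw [koszulClassHom_eq_iff.mpr hza]
  exact hmem

end Main

end

end VectorSpread

theorem mainTheorem1 {K : Type*} [Field K] {n d : ℕ} [NeZero n] (hd : 2 ≤ d)
    (t : Fin (d - 1) → ℕ) (I : Ideal (MvPolynomial (Fin n) K))
    (hI : VectorSpread.IsSpreadStronglyStable t I) (hproper : I ≠ ⊤) (i : ℕ) (hi : 1 ≤ i) :
    ∃ (hcyc : ∀ p : VectorSpread.CycleIndex t I i,
        VectorSpread.cycleE I p.1.1 p.1.2 ∈
          VectorSpread.koszulCycles (VectorSpread.varSeq I) i)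
      (b : Module.Basis (VectorSpread.CycleIndex t I i) K
        (VectorSpread.KoszulHomology (VectorSpread.varSeq I) i)),
      ∀ p : VectorSpread.CycleIndex t I i,
        b p = VectorSpread.koszulClass (VectorSpread.varSeq I) i
          ⟨VectorSpread.cycleE I p.1.1 p.1.2, hcyc p⟩ := by
  exact ⟨VectorSpread.cycleE_mem_koszulCycles hI hproper hi,
    Module.Basis.mk (VectorSpread.linearIndependent_koszulClassHom hI hproper hi)
      (VectorSpread.span_koszulClassHom_eq_top hI hproper hi).ge,
    fun p => Module.Basis.mk_apply _ _ p⟩
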